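/- Let $d,r$ be natural numbers, and let $A,B,X,Y$ be invertible real $d\times d$ matrices such that $A$ and $B$ are expansive (all complex eigenvalues have modulus $>1$), $X^{-1}AX$ has integer entries, and $X^{-1}AX\neq Y^{-1}BY$. Write $C^*$ for the transpose of a matrix $C$ and $C'=(C^*)^{-1}$. For $f\in L^2(\mathbb R^d)$ let $\hat f$ be the Fourier transform, normalized by $\hat f(\xi)=\int f(x)e^{-2\pi i x\cdot\xi}\,dx$ on $L^1\cap L^2$, and put $T_\alpha f=f(\cdot-\alpha)$, $D_Af=\sqrt{|\det A|}\,f(A\,\cdot)$, $\widetilde D_Af=|\det A|\,f(A\,\cdot)$. For $\Psi=(\psi_1,\dots,\psi_r)$ in $L^2(\mathbb R^d)$, the quasi-affine system $\mathcal U^q_{A,X}(\Psi)=(u_{n,z,i})$ is the family indexed by $(n,z,i)\in\mathbb Z\times\mathbb Z^d\times\{1,\dots,r\}$ with $u_{n,z,i}=D_A^nT_{Xz}\psi_i$ for $n\ge 0$ and $u_{n,z,i}=T_{Xz}\widetilde D_A^{\,n}\psi_i$ for $n<0$. A family $(x_j)_{j\in J}$ in a Hilbert space $H$ is Bessel if there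 is a constant $C$ with $\sum_j|\langle v,x_j\rangle|^2\le C\|v\|^2$ for all $v\in H$; two Bessel families $(x_j)_{j\in J}$, $(y_j)_{j\in J}$ are orthogonal if $\sum_j\langle v,x_j\rangle\, y_j=0$ for all $v\in H$. Let $\Psi=(\psi_1,\dots,\psi_r)$ and $\Phi=(\varphi_1,\dots,\varphi_r)$ be in $L^2(\mathbb R^d)$ and suppose that $\mathcal U^q_{A,X}(\Psi)$ and $\mathcal U^q_{B,Y}(\Phi)$ are Bessel. Then the series over $j$ in (2) below converges absolutely for every $k\in\mathbb Z^d$, almost every $\xi\in\mathbb R^d$ and every $i$, and the two systems are orthogonal if and only if 1. for every $k\in\mathbb Z^d$, $\displaystyle\sum_{i=1}^r\overline{\hat\psi_i(X'\xi)}\,\hat\varphi_i(Y'(\xi+k))=0$ for a.e. $\xi\in\mathbb R^d$; and 2. for every $k\in\mathbb Z^d$, $\displaystyle\sum_{i=1}^r\sum_{j>0}\overline{\hat\psi_i(A^{*j}X'\xi)}\,\hat\varphi_i(B^{*j}Y'(\xi+k))=0$ for a.e. $\xi\in\mathbb R^d$. -/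

import Mathlib

open MeasureTheory
open scoped FourierTransform ComplexConjugate

noncomputable section

namespace OrthogonalTranslates

/-! ### Bessel sequences and orthogonality in a Hilbert space -/

section Bessel

variable {H : Type*} [NormedAddCommGroup H] [InnerProductSpace ℂ H] {J : Type*}

/-- The family `x` is a Bessel sequence: there is a constant `C` with
`∑ j, |⟨v, x j⟩|² ≤ C ‖v‖²` (a convergent sum) for all `v`. -/
def IsBessel (x : J → H) : Prop :=
  ∃ C : ℝ, ∀ v : H,
    Summable (fun j => ‖inner ℂ (x j) v‖ ^ 2) ∧
      ∑' j, ‖inner ℂ (x j) v‖ ^ 2 ≤ C * ‖v‖ ^ 2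

/-- The families `x` and `y` (with the same index set) are orthogonal: the operator
`v ↦ ∑ j, ⟨v, x j⟩ y j` is zero. Mathlib's `inner` is linear in its second argument, so
`⟨v, x j⟩` (linear in `v`) is `inner ℂ (x j) v`. For two Bessel sequences the series
converges unconditionally in norm for every `v`. -/
def IsOrthogonal (x y : J → H) : Prop :=
  ∀ v : H, HasSum (fun j => inner ℂ (x j) v • y j) 0

end Bessel

/-! ### Matrices acting on Euclidean space -/

variable {d : ℕ}

/-- All complex eigenvalues of the real matrix `A` have modulus strictly greater than `1`. -/
def IsExpansive (A : Matrix (Fin d) (Fin d) ℝ) : Prop :=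
  ∀ μ : ℂ,
    Module.End.HasEigenvalue (Matrix.toLin' (A.map (algebraMap ℝ ℂ))) μ → 1 < ‖μ‖

/-- All entries of the real matrix `A` are integers. -/
def IsIntegerMatrix (A : Matrix (Fin d) (Fin d) ℝ) : Prop :=
  ∀ i j, ∃ m : ℤ, A i j = m

/-- An integer vector as a point of `ℝ^d`. -/
def intVec (z : Fin d → ℤ) : EuclideanSpace ℝ (Fin d) :=
  WithLp.toLp 2 (fun i => (z i : ℝ))

/-- `C'`, the inverse of the transpose of `C`. -/
def invTranspose (C : GL (Fin d) ℝ) : Matrix (Fin d) (Fin d) ℝ :=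
  ((C : Matrix (Fin d) (Fin d) ℝ).transpose)⁻¹

/-! ### Translations and dilations on `L²(ℝ^d)` -/

variable (d) in
/-- The complex Hilbert space `L²(ℝ^d)`. -/
abbrev L2 : Type := Lp (α := EuclideanSpace ℝ (Fin d)) ℂ 2 volume

/-- The translation `(T_α f)(x) = f(x - α)`. -/
def translation (α : EuclideanSpace ℝ (Fin d)) (f : L2 d) : L2 d :=
  Lp.compMeasurePreserving (fun x => x - α) (measurePreserving_sub_right volume α) f

lemma det_toEuclideanLin_ne_zero (A : GL (Fin d) ℝ) :
    LinearMap.det (Matrix.toEuclideanLin (A : Matrix (Fin d) (Fin d) ℝ)) ≠ 0 := by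
  rw [Matrix.toEuclideanLin, Matrix.toLpLin_eq_toLin, LinearMap.det_toLin]
  exact (Matrix.isUnit_iff_isUnit_det _).1 A.isUnit |>.ne_zero

lemma quasiMeasurePreserving_toEuclideanLin (A : GL (Fin d) ℝ) :
    Measure.QuasiMeasurePreserving
      (Matrix.toEuclideanLin (A : Matrix (Fin d) (Fin d) ℝ)) volume volume :=
  Measure.LinearMap.quasiMeasurePreserving volume _ (det_toEuclideanLin_ne_zero A)

lemma memLp_dilate (c : ℂ) (A : GL (Fin d) ℝ) (f : L2 d) :
    MemLp (fun x => c * f (Matrix.toEuclideanLin (A : Matrix (Fin d) (Fin d) ℝ) x)) 2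
      volume := by
  have h : MemLp f 2 (Measure.map (Matrix.toEuclideanLin (A : Matrix (Fin d) (Fin d) ℝ))
      volume) := by
    rw [Measure.map_linearMap_addHaar_eq_smul_addHaar _ (det_toEuclideanLin_ne_zero A)]
    exact (Lp.memLp f).smul_measure ENNReal.ofReal_ne_top
  exact (h.comp_of_map
    (quasiMeasurePreserving_toEuclideanLin A).measurable.aemeasurable).const_mul c

/-- The function `x ↦ c * f (A x)` as an element of `L²(ℝ^d)`. -/
def dilate (c : ℂ) (A : GL (Fin d) ℝ) (f : L2 d) : L2 d :=
  (memLp_dilate c A f).toLp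

lemma coeFn_dilate (c : ℂ) (A : GL (Fin d) ℝ) (f : L2 d) :
    dilate c A f =ᵐ[volume]
      fun x => c * f (Matrix.toEuclideanLin (A : Matrix (Fin d) (Fin d) ℝ) x) :=
  (memLp_dilate c A f).coeFn_toLp

lemma dilate_dilate (c c' : ℂ) (A A' : GL (Fin d) ℝ) (h : A' * A = 1) (hc : c * c' = 1)
    (f : L2 d) : dilate c A (dilate c' A' f) = f := by
  apply Lp.ext
  filter_upwards [coeFn_dilate c A (dilate c' A' f),
    (quasiMeasurePreserving_toEuclideanLin A).ae (coeFn_dilate c' A' f)] with x h1 h2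
  have h3 : (A' : Matrix (Fin d) (Fin d) ℝ) * (A : Matrix (Fin d) (Fin d) ℝ) = 1 := by
    rw [← Units.val_mul, h, Units.val_one]
  rw [h1, h2, ← mul_assoc, hc, one_mul]
  congr 1
  simp [Matrix.toLpLin_apply, Matrix.mulVec_mulVec, h3]

/-- For `c ≠ 0`, the linear automorphism `f ↦ c f(A ·)` of `L²(ℝ^d)`. -/
def dilateEquiv (c : ℂ) (hc : c ≠ 0) (A : GL (Fin d) ℝ) : L2 d ≃ₗ[ℂ] L2 d where
  toFun := dilate c A
  invFun := dilate c⁻¹ A⁻¹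
  map_add' f g := by
    apply Lp.ext
    filter_upwards [coeFn_dilate c A (f + g), coeFn_dilate c A f, coeFn_dilate c A g,
      Lp.coeFn_add (dilate c A f) (dilate c A g),
      (quasiMeasurePreserving_toEuclideanLin A).ae (Lp.coeFn_add f g)] with x h1 h2 h3 h4 h5
    rw [h1, h4, Pi.add_apply, h2, h3, h5, Pi.add_apply, mul_add]
  map_smul' a f := by
    apply Lp.ext
    filter_upwards [coeFn_dilate c A (a • f), coeFn_dilate c A f,
      Lp.coeFn_smul a (dilate c A f),
      (quasiMeasurePreserving_toEuclideanLin A).ae (Lp.coeFn_smul a f)] with x h1 h2 h3 h4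
    simp only [RingHom.id_apply]
    rw [h1, h3, Pi.smul_apply, h2, h4, Pi.smul_apply, smul_eq_mul, smul_eq_mul]
    ring
  left_inv f := dilate_dilate _ _ _ _ (mul_inv_cancel A) (inv_mul_cancel₀ hc) f
  right_inv f := dilate_dilate _ _ _ _ (inv_mul_cancel A) (mul_inv_cancel₀ hc) f

lemma abs_det_pos (A : GL (Fin d) ℝ) : 0 < |(A : Matrix (Fin d) (Fin d) ℝ).det| :=
  abs_pos.2 ((Matrix.isUnit_iff_isUnit_det _).1 A.isUnit).ne_zero

/-- The dilation `D_A f = √|det A| f(A ·)`. -/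
def dilation (A : GL (Fin d) ℝ) : L2 d ≃ₗ[ℂ] L2 d :=
  dilateEquiv (Real.sqrt |(A : Matrix (Fin d) (Fin d) ℝ).det| : ℝ)
    (Complex.ofReal_ne_zero.2 (Real.sqrt_ne_zero'.2 (abs_det_pos A))) A

/-- The renormalized dilation `D̃_A f = |det A| f(A ·)`. -/
def renormDilation (A : GL (Fin d) ℝ) : L2 d ≃ₗ[ℂ] L2 d :=
  dilateEquiv (|(A : Matrix (Fin d) (Fin d) ℝ).det| : ℝ)
    (Complex.ofReal_ne_zero.2 (abs_det_pos A).ne') A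

/-- The quasi-affine system generated by `Ψ = (ψ_1, …, ψ_r)`, indexed by
`(n, z, i) ∈ ℤ × ℤ^d × {1, …, r}`: the element with index `(n, z, i)` is
`D_A^n T_{Xz} ψ_i` for `n ≥ 0` and `T_{Xz} D̃_A^n ψ_i` for `n < 0`. The powers are integer
powers in the group of linear automorphisms of `L²(ℝ^d)`. -/
def quasiAffine {r : ℕ} (A X : GL (Fin d) ℝ) (Ψ : Fin r → L2 d) :
    ℤ × (Fin d → ℤ) × Fin r → L2 d := fun p =>
  let α := Matrix.toEuclideanLin (X : Matrix (Fin d) (Fin d) ℝ) (intVec p.2.1)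
  if 0 ≤ p.1 then (dilation A ^ p.1) (translation α (Ψ p.2.2))
  else translation α ((renormDilation A ^ p.1) (Ψ p.2.2))

end OrthogonalTranslates

end

open OrthogonalTranslates

/-!
Two Bessel families are orthogonal when their mixed frame operator `v ↦ ∑ j, ⟨v, x j⟩ y j`
vanishes. For two quasi-affine systems this operator is `S + N`, where `S` collects the indices
`n ≥ 0` and `N` the indices `n < 0`. Both `N` and the contribution `S₀` of `n = 0` intertwine the
translations `T_{Xz}` with `T_{Yz}`, and `S = S₀ + D_B S D_A⁻¹`. If `S + N = 0`, then `S = -N` and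
`D_B S D_A⁻¹ = S - S₀` intertwine these translations as well. For `w ∈ ℤ^d` the vector
`u = X⁻¹AXw` is again integral, and moving `T_{Xw}` through `D_B S D_A⁻¹` shows that the
translations by `Yu` and by `BYw` agree on the range of `S`. Since `X⁻¹AX ≠ Y⁻¹BY`, they are
different translations for some `w`; as a nontrivial translation has no nonzero fixed vector in
`L²(ℝ^d)`, it follows that `S = 0`. Hence the quasi-affine systems are orthogonal if and only if
the systems of translates behind `S₀` and `N` are orthogonal separately.

For systems of translates along `Xℤ^d` and `Yℤ^d`, the Fourier transform followed by a change of
variables turns translations into multiplications by the characters of `ℤ^d`. Parseval's identity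
on each unit cube then identifies the matrix coefficients of the mixed frame operator with
integrals of the functions in conditions 1 and 2.
-/

noncomputable section

namespace OrthogonalTranslates

section Bessel

variable {H H' : Type*} [NormedAddCommGroup H] [InnerProductSpace ℂ H]
  [NormedAddCommGroup H'] [InnerProductSpace ℂ H'] {J J₁ J₂ : Type*}

lemma IsBessel.comp_injective {x : J → H} (hx : IsBessel x) {σ : J₁ → J}
    (hσ : Function.Injective σ) : IsBessel (fun j => x (σ j)) := by
  obtain ⟨C, hC⟩ := hx
  refine ⟨C, fun v => ⟨(hC v).1.comp_injective hσ, le_trans ?_ (hC v).2⟩⟩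
  exact tsum_comp_le_tsum_of_inj (hC v).1 (fun _ => by positivity) hσ

lemma IsBessel.map {x : J → H} (hx : IsBessel x) (U : H ≃ₗᵢ[ℂ] H') :
    IsBessel (fun j => U (x j)) := by
  obtain ⟨C, hC⟩ := hx
  refine ⟨C, fun v => ?_⟩
  simpa [← U.inner_map_eq_flip] using hC (U.symm v)

lemma IsBessel.memℓp_inner {x : J → H} (hx : IsBessel x) (v : H) :
    Memℓp (fun j => inner ℂ (x j) v) 2 := by
  obtain ⟨C, hC⟩ := hx
  exact memℓp_gen (by simpa using (hC v).1)

lemma IsBessel.exists_norm_le {x : J → H} (hx : IsBessel x) :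
    ∃ C : ℝ, ∀ v, ‖(⟨_, hx.memℓp_inner v⟩ : lp (fun _ : J => ℂ) 2)‖ ≤ C * ‖v‖ := by
  have ⟨C, hC⟩ := hx
  refine ⟨√C, fun v => ?_⟩
  rw [lp.norm_eq_tsum_rpow (by norm_num)]
  have := Real.sqrt_le_sqrt (hC v).2
  rw [Real.sqrt_mul' _ (by positivity), Real.sqrt_sq (norm_nonneg v)] at this
  simpa [Real.sqrt_eq_rpow] using this

/-- The analysis operator `v ↦ (⟨v, x j⟩)_j` of a Bessel sequence, with values in `ℓ²`. Its
adjoint is the synthesis operator `c ↦ ∑ j, c j • x j`. -/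
def IsBessel.analysis {x : J → H} (hx : IsBessel x) : H →L[ℂ] lp (fun _ : J => ℂ) 2 :=
  LinearMap.mkContinuousOfExistsBound
    { toFun := fun v => ⟨_, hx.memℓp_inner v⟩
      map_add' := fun v w => Subtype.ext (funext fun j => inner_add_right (x j) v w)
      map_smul' := fun c v => Subtype.ext (funext fun j => inner_smul_right (x j) v c) }
    hx.exists_norm_le

lemma IsBessel.analysis_apply {x : J → H} (hx : IsBessel x) (v : H) (j : J) :
    hx.analysis v j = inner ℂ (x j) v := rfl

lemma IsBessel.adjoint_analysis_single [CompleteSpace H] [DecidableEq J] {x : J → H}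
    (hx : IsBessel x) (j : J) (c : ℂ) :
    ContinuousLinearMap.adjoint hx.analysis (lp.single 2 j c) = c • x j := by
  refine ext_inner_right ℂ fun v => ?_
  rw [ContinuousLinearMap.adjoint_inner_left, lp.inner_single_left, hx.analysis_apply,
    inner_smul_left, RCLike.inner_apply, mul_comm]

lemma IsBessel.hasSum_smul [CompleteSpace H] {x : J → H} (hx : IsBessel x)
    (c : lp (fun _ : J => ℂ) 2) :
    HasSum (fun j => c j • x j) (ContinuousLinearMap.adjoint hx.analysis c) := by
  classical
  simpa [Function.comp_def, hx.adjoint_analysis_single] using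
    (lp.hasSum_single ENNReal.ofNat_ne_top c).mapL (ContinuousLinearMap.adjoint hx.analysis)

/-- The mixed frame operator `v ↦ ∑ j, ⟨v, x j⟩ y j` of two families; two Bessel sequences in the
same space are orthogonal when it vanishes. It is defined for arbitrary families, with the junk
value `0` where the series diverges. -/
def mixedOp (x : J → H) (y : J → H') (v : H) : H' := ∑' j, inner ℂ (x j) v • y j

section Complete

variable [CompleteSpace H'] {x : J → H} {y : J → H'}

lemma hasSum_mixedOp (hx : IsBessel x) (hy : IsBessel y) (v : H) :
    HasSum (fun j => inner ℂ (x j) v • y j) (mixedOp x y v) :=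
  (hy.hasSum_smul (hx.analysis v)).summable.hasSum

lemma mixedOp_eq_adjoint_analysis (hx : IsBessel x) (hy : IsBessel y) (v : H) :
    mixedOp x y v = ContinuousLinearMap.adjoint hy.analysis (hx.analysis v) :=
  (hy.hasSum_smul (hx.analysis v)).tsum_eq

lemma hasSum_inner_mixedOp (hx : IsBessel x) (hy : IsBessel y) (v : H) (w : H') :
    HasSum (fun j => inner ℂ (x j) v * inner ℂ w (y j)) (inner ℂ w (mixedOp x y v)) := by
  simpa [inner_smul_right] using (innerSL ℂ w).hasSum (hasSum_mixedOp hx hy v)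

lemma inner_mixedOp_swap [CompleteSpace H] (hx : IsBessel x) (hy : IsBessel y) (v : H) (w : H') :
    inner ℂ w (mixedOp x y v) = inner ℂ (mixedOp y x w) v := by
  rw [mixedOp_eq_adjoint_analysis hx hy, mixedOp_eq_adjoint_analysis hy hx,
    ContinuousLinearMap.adjoint_inner_left, ContinuousLinearMap.adjoint_inner_right]

lemma mixedOp_eq_add (hx : IsBessel x) (hy : IsBessel y) {σ : J₁ → J} {τ : J₂ → J}
    (hσ : σ.Injective) (hτ : τ.Injective) (h : IsCompl (Set.range σ) (Set.range τ)) (v : H) :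
    mixedOp x y v = mixedOp (fun j => x (σ j)) (fun j => y (σ j)) v +
      mixedOp (fun j => x (τ j)) (fun j => y (τ j)) v := by
  refine (hasSum_mixedOp hx hy v).unique (HasSum.add_isCompl h ?_ ?_)
  · exact (hσ.hasSum_range_iff (f := fun j => inner ℂ (x j) v • y j)).2
      (hasSum_mixedOp (hx.comp_injective hσ) (hy.comp_injective hσ) v)
  · exact (hτ.hasSum_range_iff (f := fun j => inner ℂ (x j) v • y j)).2
      (hasSum_mixedOp (hx.comp_injective hτ) (hy.comp_injective hτ) v)

end Complete

lemma mixedOp_map (x : J → H) (y : J → H') (U : H ≃ₗᵢ[ℂ] H) (V : H' ≃ₗᵢ[ℂ] H') (v : H) :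
    mixedOp (fun j => U (x j)) (fun j => V (y j)) (U v) = V (mixedOp x y v) := by
  simp only [mixedOp, U.inner_map_map, ← V.map_smul]
  exact (V.toContinuousLinearEquiv.map_tsum (f := fun j => inner ℂ (x j) v • y j)).symm

lemma mixedOp_comp_equiv (x : J → H) (y : J → H') (e : J₁ ≃ J) (v : H) :
    mixedOp (fun j => x (e j)) (fun j => y (e j)) v = mixedOp x y v :=
  e.tsum_eq fun j => inner ℂ (x j) v • y j

lemma isOrthogonal_map_iff {x y : J → H} (U V : H ≃ₗᵢ[ℂ] H') :
    IsOrthogonal (fun j => U (x j)) (fun j => V (y j)) ↔ IsOrthogonal x y := by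
  have h (v : H) : HasSum (fun j => inner ℂ (U (x j)) (U v) • V (y j)) 0 ↔
      HasSum (fun j => inner ℂ (x j) v • y j) 0 := by
    simpa [Function.comp_def] using
      V.toContinuousLinearEquiv.hasSum' (f := fun j => inner ℂ (x j) v • y j) (x := 0)
  exact ⟨fun h_orth v => (h v).1 (h_orth (U v)),
    fun h_orth v => by simpa using (h (U.symm v)).2 (h_orth (U.symm v))⟩

section Orthogonal

variable [CompleteSpace H] {x y : J → H}

lemma isOrthogonal_iff_mixedOp (hx : IsBessel x) (hy : IsBessel y) :
    IsOrthogonal x y ↔ ∀ v, mixedOp x y v = 0 :=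
  ⟨fun h v => (h v).tsum_eq, fun h v => h v ▸ hasSum_mixedOp hx hy v⟩

lemma isOrthogonal_of_forall_inner_eq_zero (hx : IsBessel x) (hy : IsBessel y) {T : Set H}
    (hT : ∀ w : H, (∀ v ∈ T, inner ℂ v w = 0) → w = 0)
    (h : ∀ v ∈ T, ∀ w ∈ T, inner ℂ w (mixedOp x y v) = 0) : IsOrthogonal x y := by
  have hT_zero : ∀ v ∈ T, mixedOp x y v = 0 := fun v hv => hT _ fun w hw => h v hv w hw
  have h_swap : ∀ w, mixedOp y x w = 0 := fun w => hT _ fun v hv => by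
    rw [inner_eq_zero_symm, ← inner_mixedOp_swap hx hy, hT_zero v hv, inner_zero_right]
  refine (isOrthogonal_iff_mixedOp hx hy).2 fun v => ?_
  rw [← inner_self_eq_zero (𝕜 := ℂ), inner_mixedOp_swap hx hy, h_swap, inner_zero_left]

end Orthogonal

end Bessel

section Orbit

variable {H : Type*} [NormedAddCommGroup H] [InnerProductSpace ℂ H] {J : Type*}

/-- The forward orbit `(U^n x_j)_{n ≥ 0, j}` of a family under a unitary operator. -/
def orbit (U : H ≃ₗᵢ[ℂ] H) (x : J → H) : ℕ × J → H := fun p => (U ^ p.1) (x p.2)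

lemma IsBessel.of_orbit {U : H ≃ₗᵢ[ℂ] H} {x : J → H} (hx : IsBessel (orbit U x)) : IsBessel x := by
  simpa [orbit] using hx.comp_injective (Prod.mk_right_injective 0)

variable [CompleteSpace H] {U V : H ≃ₗᵢ[ℂ] H} {x y : J → H}

lemma mixedOp_orbit (hx : IsBessel (orbit U x)) (hy : IsBessel (orbit V y)) (v : H) :
    mixedOp (orbit U x) (orbit V y) v =
      mixedOp x y v + V (mixedOp (orbit U x) (orbit V y) (U.symm v)) := by
  have h_succ : Function.Injective fun p : ℕ × J => (p.1 + 1, p.2) := fun p q h => by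
    simpa [Prod.ext_iff] using h
  have h_compl : IsCompl (Set.range (Prod.mk 0)) (Set.range fun p : ℕ × J => (p.1 + 1, p.2)) := by
    refine isCompl_iff.2 ⟨Set.disjoint_left.2 ?_, codisjoint_iff_le_sup.2 ?_⟩
    · rintro _ ⟨j, rfl⟩ ⟨p, hp⟩
      simp at hp
    · rintro ⟨_ | n, j⟩ -
      exacts [Or.inl ⟨j, rfl⟩, Or.inr ⟨(n, j), rfl⟩]
  rw [mixedOp_eq_add hx hy (Prod.mk_right_injective 0) h_succ h_compl v, ← mixedOp_map,
    U.apply_symm_apply]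
  simp only [orbit, pow_succ']
  rfl

theorem isOrthogonal_orbit_iff (hx : IsBessel (orbit U x)) (hy : IsBessel (orbit V y)) :
    IsOrthogonal (orbit U x) (orbit V y) ↔ IsOrthogonal x y := by
  constructor <;> intro h
  · rw [isOrthogonal_iff_mixedOp hx hy] at h
    refine (isOrthogonal_iff_mixedOp hx.of_orbit hy.of_orbit).2 fun v => ?_
    simpa [h] using (mixedOp_orbit hx hy v).symm
  · rw [isOrthogonal_iff_mixedOp hx.of_orbit hy.of_orbit] at h
    have h_slice (n : ℕ) (v : H) :
        mixedOp (fun j => (U ^ n) (x j)) (fun j => (V ^ n) (y j)) v = 0 := by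
      rw [← (U ^ n).apply_symm_apply v, mixedOp_map, h, map_zero]
    refine (isOrthogonal_iff_mixedOp hx hy).2 fun v => ?_
    have h_total := (hasSum_mixedOp hx hy v).prod_fiberwise fun n =>
      hasSum_mixedOp (hx.comp_injective (Prod.mk_right_injective n))
        (hy.comp_injective (Prod.mk_right_injective n)) v
    exact h_total.unique (by simpa only [orbit, h_slice] using hasSum_zero)

end Orbit

variable {d : ℕ}

section Matrices

/-- The action of `GL_d(ℝ)` on Euclidean space by continuous linear automorphisms; it coincides with
`Matrix.toEuclideanLin` on underlying matrices. -/
def toEuclideanEquiv :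
    GL (Fin d) ℝ →* (EuclideanSpace ℝ (Fin d) ≃L[ℝ] EuclideanSpace ℝ (Fin d)) :=
  (ContinuousLinearEquiv.unitsEquiv ℝ (EuclideanSpace ℝ (Fin d))).toMonoidHom.comp
    (Units.map (Matrix.toEuclideanCLM (n := Fin d) (𝕜 := ℝ) : _ →* _))

lemma toEuclideanEquiv_apply (A : GL (Fin d) ℝ) (x : EuclideanSpace ℝ (Fin d)) :
    toEuclideanEquiv A x = Matrix.toEuclideanLin (A : Matrix (Fin d) (Fin d) ℝ) x := rfl

lemma toEuclideanEquiv_mul_apply (A B : GL (Fin d) ℝ) (x : EuclideanSpace ℝ (Fin d)) :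
    toEuclideanEquiv (A * B) x = toEuclideanEquiv A (toEuclideanEquiv B x) := by
  rw [map_mul]
  rfl

/-- The contragredient representation `A ↦ A' = (Aᵀ)⁻¹` of `GL_d(ℝ)`. -/
def contragredient : GL (Fin d) ℝ →* GL (Fin d) ℝ where
  toFun A :=
    { val := invTranspose A
      inv := (A : Matrix (Fin d) (Fin d) ℝ).transpose
      val_inv := Matrix.nonsing_inv_mul _ (by simpa using abs_pos.1 (abs_det_pos A))
      inv_val := Matrix.mul_nonsing_inv _ (by simpa using abs_pos.1 (abs_det_pos A)) }
  map_one' := Units.ext (by simp [invTranspose])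
  map_mul' A B := Units.ext (by simp [invTranspose, Matrix.mul_inv_rev])

lemma coe_contragredient (A : GL (Fin d) ℝ) :
    (contragredient A : Matrix (Fin d) (Fin d) ℝ) = invTranspose A := rfl

lemma coe_contragredient_inv (A : GL (Fin d) ℝ) :
    (contragredient A⁻¹ : Matrix (Fin d) (Fin d) ℝ) =
      (A : Matrix (Fin d) (Fin d) ℝ).transpose := by
  rw [map_inv]
  rfl

lemma inner_toEuclideanEquiv_contragredient (A : GL (Fin d) ℝ) (x y : EuclideanSpace ℝ (Fin d)) :
    inner ℝ (toEuclideanEquiv A x) (toEuclideanEquiv (contragredient A) y) = inner ℝ x y := by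
  rw [toEuclideanEquiv_apply, ← LinearMap.adjoint_inner_right,
    ← Matrix.toEuclideanLin_conjTranspose_eq_adjoint,
    Matrix.conjTranspose_eq_transpose_of_trivial, ← coe_contragredient_inv,
    ← toEuclideanEquiv_apply, ← toEuclideanEquiv_mul_apply, ← map_mul, inv_mul_cancel, map_one,
    map_one]
  rfl

lemma ae_comp_toEuclideanEquiv {p : EuclideanSpace ℝ (Fin d) → Prop} (A : GL (Fin d) ℝ)
    (h : ∀ᵐ x, p x) : ∀ᵐ x, p (toEuclideanEquiv A x) :=
  (quasiMeasurePreserving_toEuclideanLin A).ae h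

lemma integral_comp_toEuclideanEquiv {F : Type*} [NormedAddCommGroup F] [NormedSpace ℝ F]
    (A : GL (Fin d) ℝ) (f : EuclideanSpace ℝ (Fin d) → F) :
    ∫ x, f (toEuclideanEquiv A x) =
      |(A : Matrix (Fin d) (Fin d) ℝ).det|⁻¹ • ∫ x, f x := by
  have h_det : LinearMap.det (Matrix.toEuclideanLin (A : Matrix (Fin d) (Fin d) ℝ)) =
      (A : Matrix (Fin d) (Fin d) ℝ).det := by
    rw [Matrix.toEuclideanLin, Matrix.toLpLin_eq_toLin, LinearMap.det_toLin]
  have h_map : Measure.map (toEuclideanEquiv A) volume =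
      ENNReal.ofReal |(A : Matrix (Fin d) (Fin d) ℝ).det|⁻¹ • volume := by
    rw [← h_det, ← abs_inv]
    exact Measure.map_linearMap_addHaar_eq_smul_addHaar _ (det_toEuclideanLin_ne_zero A)
  have h_integral := (toEuclideanEquiv A).toHomeomorph.measurableEmbedding.integral_map
    (μ := volume) f
  simp only [ContinuousLinearEquiv.coe_toHomeomorph] at h_integral
  rw [← h_integral, h_map, integral_smul_measure,
    ENNReal.toReal_ofReal (by positivity)]

end Matrices

section Operators

lemma ae_comp_add_right {p : EuclideanSpace ℝ (Fin d) → Prop} (α : EuclideanSpace ℝ (Fin d))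
    (h : ∀ᵐ x, p x) : ∀ᵐ x, p (x + α) :=
  (measurePreserving_add_right volume α).quasiMeasurePreserving.ae h

lemma ae_comp_sub_right {p : EuclideanSpace ℝ (Fin d) → Prop} (α : EuclideanSpace ℝ (Fin d))
    (h : ∀ᵐ x, p x) : ∀ᵐ x, p (x - α) :=
  (measurePreserving_sub_right volume α).quasiMeasurePreserving.ae h

lemma coeFn_translation (α : EuclideanSpace ℝ (Fin d)) (f : L2 d) :
    translation α f =ᵐ[volume] fun x => f (x - α) :=
  Lp.coeFn_compMeasurePreserving f (measurePreserving_sub_right volume α)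

lemma translation_translation (α β : EuclideanSpace ℝ (Fin d)) (f : L2 d) :
    translation α (translation β f) = translation (α + β) f := by
  apply Lp.ext
  filter_upwards [coeFn_translation α (translation β f), coeFn_translation (α + β) f,
    ae_comp_sub_right α (coeFn_translation β f)] with x hα hαβ hβ
  rw [hα, hαβ, hβ, sub_sub]

lemma translation_zero (f : L2 d) : translation 0 f = f := by
  apply Lp.ext
  filter_upwards [coeFn_translation 0 f] with x hx
  rw [hx, sub_zero]

/-- The translation `T_α` as a unitary operator on `L²(ℝ^d)`. -/
def translationEquiv (α : EuclideanSpace ℝ (Fin d)) : L2 d ≃ₗᵢ[ℂ] L2 d where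
  toFun := translation α
  invFun := translation (-α)
  map_add' := map_add (Lp.compMeasurePreserving _ (measurePreserving_sub_right volume α))
  map_smul' c f :=
    (Lp.compMeasurePreservingₗ ℂ _ (measurePreserving_sub_right volume α)).map_smul c f
  left_inv f := by rw [translation_translation, neg_add_cancel, translation_zero]
  right_inv f := by rw [translation_translation, add_neg_cancel, translation_zero]
  norm_map' f := Lp.norm_compMeasurePreserving f (measurePreserving_sub_right volume α)

lemma translationEquiv_apply (α : EuclideanSpace ℝ (Fin d)) (f : L2 d) :
    translationEquiv α f = translation α f := rfl

lemma coeFn_dilation (A : GL (Fin d) ℝ) (f : L2 d) :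
    dilation A f =ᵐ[volume] fun x =>
      (√|(A : Matrix (Fin d) (Fin d) ℝ).det| : ℂ) * f (toEuclideanEquiv A x) :=
  coeFn_dilate _ A f

lemma sqrt_abs_det_ne_zero (A : GL (Fin d) ℝ) :
    (√|(A : Matrix (Fin d) (Fin d) ℝ).det| : ℂ) ≠ 0 :=
  Complex.ofReal_ne_zero.2 (Real.sqrt_ne_zero'.2 (abs_det_pos A))

lemma norm_sq_eq_integral_norm_sq {α F : Type*} [MeasurableSpace α] {μ : Measure α}
    [NormedAddCommGroup F] [InnerProductSpace ℂ F] (f : Lp F 2 μ) :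
    ‖f‖ ^ 2 = ∫ x, ‖f x‖ ^ 2 ∂μ := by
  have h := inner_self_eq_norm_sq_to_K (𝕜 := ℂ) f
  rw [L2.inner_def] at h
  simp only [inner_self_eq_norm_sq_to_K] at h
  exact_mod_cast h.symm

lemma norm_dilation (A : GL (Fin d) ℝ) (f : L2 d) : ‖dilation A f‖ = ‖f‖ := by
  refine (pow_left_inj₀ (norm_nonneg _) (norm_nonneg _) two_ne_zero).1 ?_
  have h : (fun x => ‖dilation A f x‖ ^ 2) =ᵐ[volume] fun x =>
      |(A : Matrix (Fin d) (Fin d) ℝ).det| * ‖f (toEuclideanEquiv A x)‖ ^ 2 := by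
    filter_upwards [coeFn_dilation A f] with x hx
    rw [hx, norm_mul, mul_pow, Complex.norm_real, Real.norm_eq_abs, sq_abs,
      Real.sq_sqrt (abs_nonneg _)]
  rw [norm_sq_eq_integral_norm_sq, norm_sq_eq_integral_norm_sq, integral_congr_ae h,
    integral_const_mul, integral_comp_toEuclideanEquiv A fun y => ‖f y‖ ^ 2, smul_eq_mul,
    mul_inv_cancel_left₀ (abs_det_pos A).ne']

/-- The dilation `D_A` as a unitary operator on `L²(ℝ^d)`. -/
def dilationEquiv (A : GL (Fin d) ℝ) : L2 d ≃ₗᵢ[ℂ] L2 d :=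
  ⟨dilation A, norm_dilation A⟩

lemma translation_dilation (A : GL (Fin d) ℝ) (α : EuclideanSpace ℝ (Fin d)) (f : L2 d) :
    translation α (dilation A f) = dilation A (translation (toEuclideanEquiv A α) f) := by
  apply Lp.ext
  filter_upwards [coeFn_translation α (dilation A f), ae_comp_sub_right α (coeFn_dilation A f),
    coeFn_dilation A (translation (toEuclideanEquiv A α) f),
    ae_comp_toEuclideanEquiv A (coeFn_translation (toEuclideanEquiv A α) f)] with x h₁ h₂ h₃ h₄
  rw [h₁, h₂, h₃, h₄, map_sub]

lemma coeFn_renormDilation (A : GL (Fin d) ℝ) (f : L2 d) :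
    renormDilation A f =ᵐ[volume] fun x =>
      (|(A : Matrix (Fin d) (Fin d) ℝ).det| : ℝ) * f (toEuclideanEquiv A x) :=
  coeFn_dilate _ A f

lemma renormDilation_eq_smul_dilation (A : GL (Fin d) ℝ) (f : L2 d) :
    renormDilation A f = (√|(A : Matrix (Fin d) (Fin d) ℝ).det| : ℂ) • dilation A f := by
  apply Lp.ext
  filter_upwards [coeFn_renormDilation A f, coeFn_dilation A f,
    Lp.coeFn_smul (√|(A : Matrix (Fin d) (Fin d) ℝ).det| : ℂ) (dilation A f)] with x h₁ h₂ h₃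
  rw [h₁, h₃, Pi.smul_apply, h₂, smul_eq_mul, ← mul_assoc, ← Complex.ofReal_mul,
    Real.mul_self_sqrt (abs_nonneg _)]

end Operators

section Fourier

/-- The character `ξ ↦ exp (-2πi ⟨α, ξ⟩)` of `ℝ^d`, through which `T_α` acts on Fourier
transforms. -/
def character (α ξ : EuclideanSpace ℝ (Fin d)) : ℂ := Real.fourierChar (-inner ℝ α ξ)

lemma character_eq_exp (α ξ : EuclideanSpace ℝ (Fin d)) :
    character α ξ = Complex.exp (↑(2 * Real.pi * -inner ℝ α ξ) * Complex.I) :=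
  Real.fourierChar_apply _

lemma continuous_character (α : EuclideanSpace ℝ (Fin d)) : Continuous (character α) := by
  unfold character
  fun_prop

lemma norm_character (α ξ : EuclideanSpace ℝ (Fin d)) : ‖character α ξ‖ = 1 :=
  Circle.norm_coe _

lemma ae_character_ne_one {α : EuclideanSpace ℝ (Fin d)} (hα : α ≠ 0) :
    ∀ᵐ ξ, character α ξ ≠ 1 := by
  have h_surj : Function.Surjective (innerₗ (EuclideanSpace ℝ (Fin d)) α) :=
    LinearMap.surjective fun h => hα (by simpa using LinearMap.congr_fun h α)
  have h_ae : ∀ᵐ ξ, innerₗ (EuclideanSpace ℝ (Fin d)) α ξ ∈ (Set.range ((↑) : ℤ → ℝ))ᶜ := by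
    rw [ae_comp_linearMap_mem_iff _ _ volume h_surj
      (Set.countable_range _).measurableSet.compl]
    exact (Set.countable_range _).ae_notMem _
  filter_upwards [h_ae] with ξ hξ h_one
  rw [character_eq_exp, Complex.exp_eq_one_iff] at h_one
  obtain ⟨n, hn⟩ := h_one
  refine hξ ⟨-n, ?_⟩
  rw [← mul_assoc, mul_left_inj' Complex.I_ne_zero, mul_comm (n : ℂ)] at hn
  have hn' : 2 * Real.pi * -inner ℝ α ξ = 2 * Real.pi * n := by exact_mod_cast hn
  rw [Int.cast_neg, ← mul_left_cancel₀ Real.two_pi_pos.ne' hn', neg_neg, innerₗ_apply_apply]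

lemma memLp_character_mul (α : EuclideanSpace ℝ (Fin d)) (f : L2 d) :
    MemLp (fun ξ => character α ξ * f ξ) 2 volume :=
  (Lp.memLp f).of_le ((continuous_character α).aestronglyMeasurable.mul
    (Lp.aestronglyMeasurable f)) (.of_forall fun ξ => by
      rw [norm_mul, norm_character, one_mul])

/-- Multiplication of a function in `L²(ℝ^d)` by the character of `α`. -/
def modulation (α : EuclideanSpace ℝ (Fin d)) (f : L2 d) : L2 d :=
  (memLp_character_mul α f).toLp

lemma coeFn_modulation (α : EuclideanSpace ℝ (Fin d)) (f : L2 d) :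
    modulation α f =ᵐ[volume] fun ξ => character α ξ * f ξ :=
  (memLp_character_mul α f).coeFn_toLp

lemma continuous_modulation (α : EuclideanSpace ℝ (Fin d)) :
    Continuous (modulation α : L2 d → L2 d) := by
  refine (LipschitzWith.of_dist_le_mul (K := 1) fun f g => ?_).continuous
  rw [dist_eq_norm, dist_eq_norm, NNReal.coe_one, one_mul]
  refine Lp.norm_le_norm_of_ae_le ?_
  filter_upwards [Lp.coeFn_sub (modulation α f) (modulation α g), Lp.coeFn_sub f g,
    coeFn_modulation α f, coeFn_modulation α g] with x h_mod h_sub hf hg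
  rw [h_mod, h_sub, Pi.sub_apply, Pi.sub_apply, hf, hg, ← mul_sub, norm_mul, norm_character,
    one_mul]

lemma eq_of_forall_schwartzMap_eq {Z : Type*} [TopologicalSpace Z] [T2Space Z] {S T : L2 d → Z}
    (hS : Continuous S) (hT : Continuous T)
    (h : ∀ φ : SchwartzMap (EuclideanSpace ℝ (Fin d)) ℂ, S (φ.toLp 2) = T (φ.toLp 2)) : S = T :=
  (SchwartzMap.denseRange_toLpCLM (E := EuclideanSpace ℝ (Fin d)) (F := ℂ) (p := 2)
    ENNReal.ofNat_ne_top).equalizer hS hT (funext h)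

section FunctionTransforms

variable {F : Type*} [NormedAddCommGroup F] [NormedSpace ℂ F]

lemma fourier_comp_sub_right (φ : EuclideanSpace ℝ (Fin d) → F) (α ξ : EuclideanSpace ℝ (Fin d)) :
    𝓕 (fun x => φ (x - α)) ξ = character α ξ • 𝓕 φ ξ := by
  have h := congrFun (VectorFourier.fourierIntegral_comp_add_right Real.fourierChar volume
    (innerₗ (EuclideanSpace ℝ (Fin d))) φ (-α)) ξ
  rw [map_neg, LinearMap.neg_apply, innerₗ_apply_apply, Circle.smul_def] at h
  simp only [Function.comp_def, ← sub_eq_add_neg] at h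
  exact h

lemma fourier_comp_toEuclideanEquiv (φ : EuclideanSpace ℝ (Fin d) → F) (A : GL (Fin d) ℝ)
    (ξ : EuclideanSpace ℝ (Fin d)) :
    𝓕 (fun x => φ (toEuclideanEquiv A x)) ξ =
      |(A : Matrix (Fin d) (Fin d) ℝ).det|⁻¹ •
        𝓕 φ (toEuclideanEquiv (contragredient A) ξ) := by
  rw [Real.fourier_eq, Real.fourier_eq, ← integral_comp_toEuclideanEquiv A]
  simp only [inner_toEuclideanEquiv_contragredient]

end FunctionTransforms

lemma fourier_translation (α : EuclideanSpace ℝ (Fin d)) (f : L2 d) :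
    (𝓕 (translation α f) : L2 d) = modulation α (𝓕 f : L2 d) := by
  refine congrFun (eq_of_forall_schwartzMap_eq (S := fun f => (𝓕 (translation α f) : L2 d))
    (T := fun f => modulation α (𝓕 f : L2 d))
    ((Lp.fourierTransformₗᵢ _ ℂ).continuous.comp (translationEquiv α).continuous)
    ((continuous_modulation α).comp (Lp.fourierTransformₗᵢ _ ℂ).continuous) fun φ => ?_) f
  have h_translation : translation α (φ.toLp 2) = (φ.compSubConstCLM ℂ α).toLp 2 := by
    apply Lp.ext
    filter_upwards [coeFn_translation α (φ.toLp 2), ae_comp_sub_right α (φ.coeFn_toLp 2 volume),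
      (φ.compSubConstCLM ℂ α).coeFn_toLp 2 volume] with x h₁ h₂ h₃
    rw [h₁, h₂, h₃, SchwartzMap.compSubConstCLM_apply]
  simp only [h_translation, SchwartzMap.toLp_fourier_eq]
  apply Lp.ext
  filter_upwards [coeFn_modulation α ((𝓕 φ).toLp 2), (𝓕 φ).coeFn_toLp 2 volume,
    (𝓕 (φ.compSubConstCLM ℂ α)).coeFn_toLp 2 volume] with ξ h₁ h₂ h₃
  rw [h₁, h₂, h₃, SchwartzMap.fourier_coe, SchwartzMap.fourier_coe]
  exact fourier_comp_sub_right φ α ξ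

lemma eq_zero_of_translation_eq_self {α : EuclideanSpace ℝ (Fin d)} (hα : α ≠ 0) {f : L2 d}
    (h : translation α f = f) : f = 0 := by
  have h_modulation : (𝓕 f : L2 d) = modulation α (𝓕 f : L2 d) := by
    rw [← fourier_translation, h]
  refine (Lp.fourierTransformₗᵢ _ ℂ).map_eq_zero_iff.1 (Lp.eq_zero_iff_ae_eq_zero.2 ?_)
  have h_ae := coeFn_modulation α (𝓕 f : L2 d)
  rw [← h_modulation] at h_ae
  filter_upwards [h_ae, ae_character_ne_one hα] with ξ hξ h_ne
  exact (mul_left_eq_self₀.1 hξ.symm).resolve_left h_ne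

lemma eq_zero_of_translation_eq_translation {α β : EuclideanSpace ℝ (Fin d)} (hαβ : α ≠ β)
    {f : L2 d} (h : translation α f = translation β f) : f = 0 := by
  refine eq_zero_of_translation_eq_self (sub_ne_zero.2 hαβ.symm) (f := f) ?_
  rw [sub_eq_neg_add, ← translation_translation, ← h, translation_translation, neg_add_cancel,
    translation_zero]

lemma sqrt_abs_det_contragredient (A : GL (Fin d) ℝ) :
    √|(contragredient A : Matrix (Fin d) (Fin d) ℝ).det| =
      (√|(A : Matrix (Fin d) (Fin d) ℝ).det|)⁻¹ := by
  rw [coe_contragredient, invTranspose, Matrix.det_nonsing_inv, Matrix.det_transpose,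
    Ring.inverse_eq_inv', abs_inv, Real.sqrt_inv]

lemma fourier_dilation (A : GL (Fin d) ℝ) (f : L2 d) :
    (𝓕 (dilation A f) : L2 d) = dilation (contragredient A) (𝓕 f : L2 d) := by
  refine congrFun (eq_of_forall_schwartzMap_eq (S := fun f => (𝓕 (dilation A f) : L2 d))
    (T := fun f => dilation (contragredient A) (𝓕 f : L2 d))
    ((Lp.fourierTransformₗᵢ _ ℂ).continuous.comp (dilationEquiv A).continuous)
    ((dilationEquiv _).continuous.comp (Lp.fourierTransformₗᵢ _ ℂ).continuous) fun φ => ?_) f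
  set c : ℝ := √|(A : Matrix (Fin d) (Fin d) ℝ).det| with hc
  set φA := SchwartzMap.compCLMOfContinuousLinearEquiv ℂ (toEuclideanEquiv A) φ
  have h_dilation : dilation A (φ.toLp 2) = ((c : ℂ) • φA).toLp 2 := by
    apply Lp.ext
    filter_upwards [coeFn_dilation A (φ.toLp 2),
      ae_comp_toEuclideanEquiv A (φ.coeFn_toLp 2 volume),
      ((c : ℂ) • φA).coeFn_toLp 2 volume] with x h₁ h₂ h₃
    rw [h₁, h₂, h₃]
    rfl
  have h_fourier (ξ : EuclideanSpace ℝ (Fin d)) :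
      𝓕 φA ξ = (c : ℂ)⁻¹ ^ 2 * 𝓕 φ (toEuclideanEquiv (contragredient A) ξ) := by
    rw [SchwartzMap.fourier_coe, SchwartzMap.fourier_coe, ← Complex.ofReal_inv,
      ← Complex.ofReal_pow, inv_pow, hc, Real.sq_sqrt (abs_nonneg _), ← Complex.real_smul]
    exact fourier_comp_toEuclideanEquiv φ A ξ
  simp only [h_dilation, SchwartzMap.toLp_fourier_eq, FourierTransform.fourier_smul]
  apply Lp.ext
  filter_upwards [coeFn_dilation (contragredient A) ((𝓕 φ).toLp 2),
    ae_comp_toEuclideanEquiv (contragredient A) ((𝓕 φ).coeFn_toLp 2 volume),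
    ((c : ℂ) • 𝓕 φA).coeFn_toLp 2 volume] with ξ h₁ h₂ h₃
  have hc_ne : (c : ℂ) ≠ 0 := sqrt_abs_det_ne_zero A
  rw [h₁, h₂, h₃, smul_apply, h_fourier, sqrt_abs_det_contragredient, smul_eq_mul,
    ← mul_assoc, Complex.ofReal_inv, sq, mul_inv_cancel_left₀ hc_ne]

lemma fourier_renormDilation (A : GL (Fin d) ℝ) (f : L2 d) :
    (𝓕 (renormDilation A f) : L2 d) =ᵐ[volume]
      fun ξ => (𝓕 f : L2 d) (toEuclideanEquiv (contragredient A) ξ) := by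
  rw [renormDilation_eq_smul_dilation, FourierTransform.fourier_smul, fourier_dilation]
  filter_upwards [coeFn_dilation (contragredient A) (𝓕 f : L2 d),
    Lp.coeFn_smul (√|(A : Matrix (Fin d) (Fin d) ℝ).det| : ℂ)
      (dilation (contragredient A) (𝓕 f : L2 d))] with ξ h₁ h₂
  rw [h₂, Pi.smul_apply, h₁, sqrt_abs_det_contragredient, smul_eq_mul, Complex.ofReal_inv,
    mul_inv_cancel_left₀ (sqrt_abs_det_ne_zero A)]

lemma fourier_renormDilation_inv (A : GL (Fin d) ℝ) (f : L2 d) :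
    (𝓕 ((renormDilation A)⁻¹ f) : L2 d) =ᵐ[volume]
      fun ξ => (𝓕 f : L2 d) (toEuclideanEquiv (contragredient A⁻¹) ξ) := by
  have h := fourier_renormDilation A ((renormDilation A)⁻¹ f)
  rw [← LinearEquiv.mul_apply, mul_inv_cancel, LinearEquiv.coe_one, id] at h
  filter_upwards [ae_comp_toEuclideanEquiv (contragredient A⁻¹) h] with ξ hξ
  rw [hξ, ← toEuclideanEquiv_mul_apply, ← map_mul, mul_inv_cancel, map_one, map_one]
  rfl

lemma fourier_renormDilation_zpow (A : GL (Fin d) ℝ) (n : ℤ) (f : L2 d) :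
    (𝓕 ((renormDilation A ^ n) f) : L2 d) =ᵐ[volume]
      fun ξ => (𝓕 f : L2 d) (toEuclideanEquiv (contragredient (A ^ n)) ξ) := by
  induction n generalizing f with
  | zero =>
    simp only [zpow_zero, map_one]
    rfl
  | succ n ih =>
    rw [zpow_add_one, LinearEquiv.mul_apply]
    filter_upwards [ih (renormDilation A f),
      ae_comp_toEuclideanEquiv _ (fourier_renormDilation A f)] with ξ h₁ h₂
    rw [h₁, h₂, ← toEuclideanEquiv_mul_apply, ← map_mul, add_comm, zpow_one_add]
  | pred n ih =>
    rw [zpow_sub_one, LinearEquiv.mul_apply]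
    filter_upwards [ih ((renormDilation A)⁻¹ f),
      ae_comp_toEuclideanEquiv _ (fourier_renormDilation_inv A f)] with ξ h₁ h₂
    rw [h₁, h₂, ← toEuclideanEquiv_mul_apply, ← map_mul, zpow_sub_one,
      (Commute.refl A).inv_left.zpow_right]

end Fourier

section Series

variable {α ι F : Type*} [MeasurableSpace α] {μ : Measure α}
  [NormedAddCommGroup F] {f : ι → α → F}

lemma tsum_eLpNorm_one_ne_top (hf : ∀ i, Integrable (f i) μ)
    (hs : Summable fun i => ∫ a, ‖f i a‖ ∂μ) : ∑' i, eLpNorm (f i) 1 μ ≠ ⊤ := by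
  simpa only [eLpNorm_one_eq_lintegral_enorm, ofReal_integral_norm_eq_lintegral_enorm (hf _)]
    using hs.tsum_ofReal_ne_top

variable [Countable ι]

lemma ae_summable_norm_of_summable_integral_norm (hf : ∀ i, Integrable (f i) μ)
    (hs : Summable fun i => ∫ a, ‖f i a‖ ∂μ) : ∀ᵐ a ∂μ, Summable fun i => ‖f i a‖ :=
  summable_norm_of_tsum_eLpNorm_ne_top le_rfl (fun i => (hf i).1) (tsum_eLpNorm_one_ne_top hf hs)

lemma integrable_tsum_of_summable_integral_norm [CompleteSpace F] (hf : ∀ i, Integrable (f i) μ)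
    (hs : Summable fun i => ∫ a, ‖f i a‖ ∂μ) : Integrable (fun a => ∑' i, f i a) μ := by
  have h_finite : ∑' i, ‖(hf i).toL1 (f i)‖ₑ ≠ ⊤ := by
    simpa only [Integrable.enorm_toL1, eLpNorm_one_eq_lintegral_enorm]
      using tsum_eLpNorm_one_ne_top hf hs
  refine (L1.integrable_coeFn (∑' i, (hf i).toL1 (f i))).congr ?_
  filter_upwards [Lp.hasSum_coeFn_tsum h_finite, ae_all_iff.2 fun i => (hf i).coeFn_toL1]
    with a h_sum h_coe
  rw [← h_sum.tsum_eq]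
  exact tsum_congr h_coe

end Series

section UnitCube

/-- The half-open unit cube `∏ i, (a i, a i + 1]` with corner `a`, a fundamental domain of
`ℝ^d / ℤ^d`. -/
def unitCube (a : EuclideanSpace ℝ (Fin d)) : Set (EuclideanSpace ℝ (Fin d)) :=
  {ξ | ∀ i, ξ i ∈ Set.Ioc (a i) (a i + 1)}

lemma measurableSet_unitCube (a : EuclideanSpace ℝ (Fin d)) : MeasurableSet (unitCube a) :=
  measurableSet_setOfPred.2 <| .forall fun i => measurableSet_setOfPred.1 <|
    (EuclideanSpace.proj (𝕜 := ℝ) i).continuous.measurable measurableSet_Ioc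

lemma add_mem_unitCube_add_iff {a b ξ : EuclideanSpace ℝ (Fin d)} :
    ξ + b ∈ unitCube (a + b) ↔ ξ ∈ unitCube a := by
  simp [unitCube, add_right_comm]

lemma iUnion_unitCube_intVec : ⋃ m : Fin d → ℤ, unitCube (intVec m) = Set.univ := by
  refine Set.eq_univ_of_forall fun ξ => Set.mem_iUnion.2 ⟨fun i => ⌈ξ i⌉ - 1, fun i => ?_⟩
  simp only [intVec, Int.cast_sub, Int.cast_one, sub_add_cancel]
  exact ⟨by linarith [Int.ceil_lt_add_one (ξ i)], Int.le_ceil (ξ i)⟩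

lemma ae_of_forall_ae_restrict_unitCube {p : EuclideanSpace ℝ (Fin d) → Prop}
    (h : ∀ m : Fin d → ℤ, ∀ᵐ ξ ∂(volume.restrict (unitCube (intVec m))), p ξ) : ∀ᵐ ξ, p ξ := by
  rw [← Measure.restrict_univ (μ := volume), ← iUnion_unitCube_intVec, ae_restrict_iUnion_iff]
  exact h

lemma setIntegral_unitCube_comp_add_right {F : Type*} [NormedAddCommGroup F] [NormedSpace ℝ F]
    (f : EuclideanSpace ℝ (Fin d) → F) (a b : EuclideanSpace ℝ (Fin d)) :
    ∫ ξ in unitCube a, f (ξ + b) = ∫ ξ in unitCube (a + b), f ξ := by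
  rw [← (measurePreserving_add_right volume b).setIntegral_preimage_emb
    (measurableEmbedding_addRight b) f (unitCube (a + b))]
  congr 2
  ext ξ
  exact add_mem_unitCube_add_iff.symm

end UnitCube

section Torus

-- Mathlib states the Fourier theory of `UnitAddTorus` for these instances but keeps them local.

local instance : MeasureSpace UnitAddCircle := ⟨AddCircle.haarAddCircle⟩

local instance : Measure.IsAddHaarMeasure (volume : Measure UnitAddCircle) :=
  inferInstanceAs (Measure.IsAddHaarMeasure AddCircle.haarAddCircle)

local instance : IsProbabilityMeasure (volume : Measure UnitAddCircle) :=
  inferInstanceAs (IsProbabilityMeasure AddCircle.haarAddCircle)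

/-- The point of the unit cube with corner `a` over a given point of the torus `ℝ^d / ℤ^d`. -/
def torusLift (a : EuclideanSpace ℝ (Fin d)) (x : UnitAddTorus (Fin d)) :
    EuclideanSpace ℝ (Fin d) :=
  WithLp.toLp 2 (UnitAddTorus.measurableEquivPiIoc a x).1

lemma coe_torusLift_apply (a : EuclideanSpace ℝ (Fin d)) (x : UnitAddTorus (Fin d)) (i : Fin d) :
    ((torusLift a x i : ℝ) : UnitAddCircle) = x i := by
  have h := (UnitAddTorus.measurableEquivPiIoc a).symm_apply_apply x
  rw [UnitAddTorus.coe_symm_measurableEquivPiIoc] at h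
  exact congrFun h i

lemma measurePreserving_torusLift (a : EuclideanSpace ℝ (Fin d)) :
    MeasurePreserving (torusLift a) volume (volume.restrict (unitCube a)) := by
  have h_meas : MeasurableSet {x : Fin d → ℝ | ∀ i, x i ∈ Set.Ioc (a i) (a i + 1)} :=
    MeasurableSet.univ_pi' fun i => measurableSet_Ioc
  have h_toLp : MeasurePreserving (WithLp.toLp 2 : (Fin d → ℝ) → EuclideanSpace ℝ (Fin d))
      (volume.restrict {x : Fin d → ℝ | ∀ i, x i ∈ Set.Ioc (a i) (a i + 1)})
      (volume.restrict (unitCube a)) :=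
    (EuclideanSpace.volume_preserving_symm_measurableEquiv_toLp (Fin d)).symm.restrict_preimage
      (measurableSet_unitCube a)
  exact h_toLp.comp ((measurePreserving_subtype_coe h_meas).comp
    (UnitAddTorus.measurePreserving_equivPiIoc a))

lemma volume_unitCube (a : EuclideanSpace ℝ (Fin d)) : volume (unitCube a) = 1 := by
  simpa using ((measurePreserving_torusLift a).measure_preimage
    MeasurableSet.univ.nullMeasurableSet).symm

lemma volume_ne_top_of_subset_unitCube {a : EuclideanSpace ℝ (Fin d)}
    {s : Set (EuclideanSpace ℝ (Fin d))} (hs : s ⊆ unitCube a) : volume s ≠ ⊤ :=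
  measure_ne_top_of_subset hs (by simp [volume_unitCube])

lemma mFourier_neg_eq_character_torusLift (a : EuclideanSpace ℝ (Fin d)) (z : Fin d → ℤ)
    (x : UnitAddTorus (Fin d)) :
    UnitAddTorus.mFourier (-z) x = character (intVec z) (torusLift a x) := by
  have h_factor (i : Fin d) : fourier ((-z) i) (x i) =
      Complex.exp (((2 * Real.pi * (-(z i * torusLift a x i)) : ℝ) : ℂ) * Complex.I) := by
    rw [← coe_torusLift_apply a x i, fourier_coe_apply]
    congr 1
    push_cast [Pi.neg_apply]
    ring
  change ∏ i, fourier ((-z) i) (x i) = _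
  simp only [h_factor]
  rw [← Complex.exp_sum, character_eq_exp, ← Finset.sum_mul, ← Complex.ofReal_sum,
    ← Finset.mul_sum, Finset.sum_neg_distrib, PiLp.inner_apply]
  simp [intVec, mul_comm]

lemma setIntegral_unitCube_eq_integral_torusLift {a : EuclideanSpace ℝ (Fin d)}
    {f : EuclideanSpace ℝ (Fin d) → ℂ}
    (hf : AEStronglyMeasurable f (volume.restrict (unitCube a))) :
    ∫ ξ in unitCube a, f ξ = ∫ x, f (torusLift a x) := by
  rw [← (measurePreserving_torusLift a).map_eq] at hf ⊢
  exact integral_map (measurePreserving_torusLift a).measurable.aemeasurable hf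

lemma mFourierCoeff_comp_torusLift {a : EuclideanSpace ℝ (Fin d)}
    {f : EuclideanSpace ℝ (Fin d) → ℂ} (hf : MemLp f 2 (volume.restrict (unitCube a)))
    (z : Fin d → ℤ) :
    UnitAddTorus.mFourierCoeff ((hf.comp_measurePreserving
      (measurePreserving_torusLift a)).toLp (f ∘ torusLift a)) z =
      ∫ ξ in unitCube a, character (intVec z) ξ * f ξ := by
  rw [setIntegral_unitCube_eq_integral_torusLift (f := fun ξ => character (intVec z) ξ * f ξ)
    ((continuous_character _).aestronglyMeasurable.mul hf.1)]
  refine integral_congr_ae ?_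
  filter_upwards [(hf.comp_measurePreserving (measurePreserving_torusLift a)).coeFn_toLp]
    with x hx
  rw [hx, mFourier_neg_eq_character_torusLift a, smul_eq_mul, Function.comp_apply]

theorem hasSum_parseval_unitCube {a : EuclideanSpace ℝ (Fin d)}
    {f g : EuclideanSpace ℝ (Fin d) → ℂ} (hf : MemLp f 2 (volume.restrict (unitCube a)))
    (hg : MemLp g 2 (volume.restrict (unitCube a))) :
    HasSum (fun z : Fin d → ℤ => conj (∫ ξ in unitCube a, character (intVec z) ξ * f ξ) *
      ∫ ξ in unitCube a, character (intVec z) ξ * g ξ) (∫ ξ in unitCube a, conj (f ξ) * g ξ) := by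
  have hf' := hf.comp_measurePreserving (measurePreserving_torusLift a)
  have hg' := hg.comp_measurePreserving (measurePreserving_torusLift a)
  have h_parseval := UnitAddTorus.hasSum_prod_mFourierCoeff (hf'.toLp (f ∘ torusLift a))
    (hg'.toLp (g ∘ torusLift a))
  simp only [mFourierCoeff_comp_torusLift hf, mFourierCoeff_comp_torusLift hg] at h_parseval
  convert h_parseval using 1
  rw [setIntegral_unitCube_eq_integral_torusLift (f := fun ξ => conj (f ξ) * g ξ)
    (hf.star.1.mul hg.1)]
  refine integral_congr_ae ?_
  filter_upwards [hf'.coeFn_toLp, hg'.coeFn_toLp] with x hx hy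
  rw [hx, hy, Function.comp_apply, Function.comp_apply]

end Torus

section Modulates

lemma intVec_add (z w : Fin d → ℤ) : intVec (z + w) = intVec z + intVec w := by
  ext i
  simp [intVec]

lemma character_intVec_add_intVec (z k : Fin d → ℤ) (ξ : EuclideanSpace ℝ (Fin d)) :
    character (intVec z) (ξ + intVec k) = character (intVec z) ξ := by
  have h_inner : inner ℝ (intVec z) (intVec k) = ((∑ i, z i * k i : ℤ) : ℝ) := by
    simp [PiLp.inner_apply, intVec, mul_comm]
  rw [character_eq_exp, character_eq_exp, inner_add_right, h_inner,
    Complex.exp_eq_exp_iff_exists_int]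
  refine ⟨-∑ i, z i * k i, ?_⟩
  push_cast
  ring

/-- The indicator function of a measurable subset of a unit cube, as a test function in
`L²(ℝ^d)`. -/
def cubeIndicator {a : EuclideanSpace ℝ (Fin d)} {E : Set (EuclideanSpace ℝ (Fin d))}
    (hE : MeasurableSet E) (hEa : E ⊆ unitCube a) : L2 d :=
  indicatorConstLp 2 hE (volume_ne_top_of_subset_unitCube hEa) 1

section CubeIndicator

variable {a : EuclideanSpace ℝ (Fin d)} {E F : Set (EuclideanSpace ℝ (Fin d))}

lemma inner_cubeIndicator (hE : MeasurableSet E) (hEa : E ⊆ unitCube a) (g : L2 d) :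
    inner ℂ (cubeIndicator hE hEa) g = ∫ ξ in E, g ξ :=
  L2.inner_indicatorConstLp_one hE _ g

lemma eq_zero_of_forall_inner_cubeIndicator_eq_zero {g : L2 d}
    (h : ∀ (m : Fin d → ℤ) (E : Set (EuclideanSpace ℝ (Fin d))) (hE : MeasurableSet E)
      (hEm : E ⊆ unitCube (intVec m)), inner ℂ (cubeIndicator hE hEm) g = 0) : g = 0 := by
  refine Lp.eq_zero_iff_ae_eq_zero.2 (ae_of_forall_ae_restrict_unitCube fun m => ?_)
  have h_integrable : IntegrableOn g (unitCube (intVec m)) :=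
    integrableOn_Lp_of_measure_ne_top g one_le_two (volume_ne_top_of_subset_unitCube subset_rfl)
  refine h_integrable.ae_eq_zero_of_forall_setIntegral_eq_zero fun s hs _ => ?_
  rw [Measure.restrict_restrict hs]
  have hsm := hs.inter (measurableSet_unitCube (intVec m))
  rw [← inner_cubeIndicator hsm Set.inter_subset_right, h]

lemma inner_cubeIndicator_modulation (hE : MeasurableSet E) (hEa : E ⊆ unitCube a)
    (z : Fin d → ℤ) (g : L2 d) :
    inner ℂ (cubeIndicator hE hEa) (modulation (intVec z) g) =
      ∫ ξ in unitCube a, character (intVec z) ξ * E.indicator g ξ := by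
  rw [inner_cubeIndicator, setIntegral_congr_ae hE
    ((coeFn_modulation (intVec z) g).mono fun ξ hξ _ => hξ), ← Set.inter_eq_right.2 hEa,
    ← setIntegral_indicator hE]
  simp only [Set.indicator_mul_right, Set.inter_eq_right.2 hEa]

lemma inner_cubeIndicator_modulation_add {k : Fin d → ℤ} (hE : MeasurableSet E)
    (hEa : E ⊆ unitCube (a + intVec k)) (z : Fin d → ℤ) (g : L2 d) :
    inner ℂ (cubeIndicator hE hEa) (modulation (intVec z) g) =
      ∫ ξ in unitCube a, character (intVec z) ξ * E.indicator g (ξ + intVec k) := by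
  rw [inner_cubeIndicator_modulation, ← setIntegral_unitCube_comp_add_right]
  simp only [character_intVec_add_intVec]

lemma hasSum_inner_modulation {k : Fin d → ℤ} (hE : MeasurableSet E) (hEa : E ⊆ unitCube a)
    (hF : MeasurableSet F) (hFa : F ⊆ unitCube (a + intVec k)) (g h : L2 d) :
    HasSum (fun z : Fin d → ℤ => inner ℂ (modulation (intVec z) g) (cubeIndicator hE hEa) *
        inner ℂ (cubeIndicator hF hFa) (modulation (intVec z) h))
      (∫ ξ in E ∩ (· + intVec k) ⁻¹' F, conj (g ξ) * h (ξ + intVec k)) := by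
  have hg : MemLp (E.indicator g) 2 volume := (Lp.memLp g).indicator hE
  have hh : MemLp (fun ξ => F.indicator h (ξ + intVec k)) 2 volume :=
    ((Lp.memLp h).indicator hF).comp_measurePreserving
      (measurePreserving_add_right volume (intVec k))
  have h_meas : MeasurableSet (E ∩ (· + intVec k) ⁻¹' F) :=
    hE.inter (measurable_add_const _ hF)
  convert hasSum_parseval_unitCube (hg.restrict (unitCube a)) (hh.restrict (unitCube a)) using 1
  · ext z
    rw [← inner_cubeIndicator_modulation hE hEa, ← inner_cubeIndicator_modulation_add hF hFa,
      inner_conj_symm]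
  · rw [← Set.inter_eq_right.2 (Set.inter_subset_left.trans hEa), ← setIntegral_indicator h_meas]
    congr with ξ
    by_cases hξE : ξ ∈ E <;> by_cases hξF : ξ + intVec k ∈ F <;> simp [hξE, hξF]

end CubeIndicator

variable {ι : Type*}

/-- The products of the family `g` with all characters `e^{-2πi⟨z, ·⟩}`, `z ∈ ℤ^d`; the Fourier
image of a system of integer translates. -/
def modulates (g : ι → L2 d) : ι × (Fin d → ℤ) → L2 d := fun p =>
  modulation (intVec p.2) (g p.1)

variable {g h : ι → L2 d}

lemma summable_setIntegral_norm_sq (hg : IsBessel (modulates g))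
    (a : EuclideanSpace ℝ (Fin d)) : Summable fun i => ∫ ξ in unitCube a, ‖g i ξ‖ ^ 2 := by
  obtain ⟨C, hC⟩ := hg
  let v : L2 d := cubeIndicator (measurableSet_unitCube a) subset_rfl
  refine (hC v).1.prod.congr fun i => HasSum.tsum_eq ?_
  have h_parseval := hasSum_parseval_unitCube ((Lp.memLp (g i)).restrict (unitCube a))
    ((Lp.memLp (g i)).restrict (unitCube a))
  have h_coeff (z : Fin d → ℤ) : ‖inner ℂ (modulates g (i, z)) v‖ =
      ‖∫ ξ in unitCube a, character (intVec z) ξ * g i ξ‖ := by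
    rw [norm_inner_symm, modulates, inner_cubeIndicator, integral_congr_ae
      (ae_restrict_of_ae (coeFn_modulation (intVec z) (g i)))]
  simp only [Complex.conj_mul', ← h_coeff, ← Complex.ofReal_pow] at h_parseval
  rwa [integral_complex_ofReal, Complex.hasSum_ofReal] at h_parseval

lemma integrableOn_conj_mul_comp_add_right (f₁ f₂ : L2 d) (b : EuclideanSpace ℝ (Fin d))
    (s : Set (EuclideanSpace ℝ (Fin d))) :
    IntegrableOn (fun ξ => conj (f₁ ξ) * f₂ (ξ + b)) s :=
  ((Lp.memLp f₁).star.integrable_mul ((Lp.memLp f₂).comp_measurePreserving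
    (measurePreserving_add_right volume b))).integrableOn

lemma summable_setIntegral_norm_conj_mul (hg : IsBessel (modulates g))
    (hh : IsBessel (modulates h)) (a b : EuclideanSpace ℝ (Fin d)) :
    Summable fun i => ∫ ξ in unitCube a, ‖conj (g i ξ) * h i (ξ + b)‖ := by
  refine .of_nonneg_of_le (fun i => integral_nonneg fun ξ => norm_nonneg _) (fun i => ?_)
    ((summable_setIntegral_norm_sq hg a).add (summable_setIntegral_norm_sq hh (a + b)))
  have hg_sq : Integrable (fun ξ => ‖g i ξ‖ ^ 2) :=
    (Lp.memLp _).integrable_norm_pow two_ne_zero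
  have hh_sq : Integrable (fun ξ => ‖h i (ξ + b)‖ ^ 2) :=
    ((Lp.memLp _).integrable_norm_pow two_ne_zero).comp_add_right b
  rw [← setIntegral_unitCube_comp_add_right, ← integral_add hg_sq.integrableOn hh_sq.integrableOn]
  refine integral_mono (integrableOn_conj_mul_comp_add_right _ _ b _).norm
    (hg_sq.add hh_sq).integrableOn fun ξ => ?_
  simp only [norm_mul, RCLike.norm_conj]
  nlinarith [two_mul_le_add_sq ‖g i ξ‖ ‖h i (ξ + b)‖, norm_nonneg (g i ξ),
    norm_nonneg (h i (ξ + b))]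

lemma ae_summable_norm_conj_mul [Countable ι] (hg : IsBessel (modulates g))
    (hh : IsBessel (modulates h)) (b : EuclideanSpace ℝ (Fin d)) :
    ∀ᵐ ξ, Summable fun i => ‖conj (g i ξ) * h i (ξ + b)‖ :=
  ae_of_forall_ae_restrict_unitCube fun m => ae_summable_norm_of_summable_integral_norm
    (fun _ => integrableOn_conj_mul_comp_add_right _ _ b _)
    (summable_setIntegral_norm_conj_mul hg hh (intVec m) b)

lemma inner_mixedOp_modulates [Countable ι] (hg : IsBessel (modulates g))
    (hh : IsBessel (modulates h)) {a : EuclideanSpace ℝ (Fin d)} {k : Fin d → ℤ}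
    {E F : Set (EuclideanSpace ℝ (Fin d))} (hE : MeasurableSet E) (hEa : E ⊆ unitCube a)
    (hF : MeasurableSet F) (hFa : F ⊆ unitCube (a + intVec k)) :
    inner ℂ (cubeIndicator hF hFa)
        (mixedOp (modulates g) (modulates h) (cubeIndicator hE hEa)) =
      ∫ ξ in E ∩ (· + intVec k) ⁻¹' F, ∑' i, conj (g i ξ) * h i (ξ + intVec k) := by
  have h_fiberwise := (hasSum_inner_mixedOp hg hh (cubeIndicator hE hEa)
    (cubeIndicator hF hFa)).prod_fiberwise fun i =>
      hasSum_inner_modulation hE hEa hF hFa (g i) (h i)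
  refine h_fiberwise.unique (hasSum_integral_of_summable_integral_norm
    (fun i => integrableOn_conj_mul_comp_add_right _ _ _ _) ?_)
  refine .of_nonneg_of_le (fun i => integral_nonneg fun ξ => norm_nonneg _) (fun i => ?_)
    (summable_setIntegral_norm_conj_mul hg hh a (intVec k))
  exact setIntegral_mono_set (integrableOn_conj_mul_comp_add_right _ _ _ _).norm
    (.of_forall fun ξ => norm_nonneg _) (Set.inter_subset_left.trans hEa).eventuallyLE

theorem isOrthogonal_modulates_iff [Countable ι] (hg : IsBessel (modulates g))
    (hh : IsBessel (modulates h)) :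
    IsOrthogonal (modulates g) (modulates h) ↔
      ∀ k : Fin d → ℤ, ∀ᵐ ξ, ∑' i, conj (g i ξ) * h i (ξ + intVec k) = 0 := by
  constructor
  · intro h_orth k
    rw [isOrthogonal_iff_mixedOp hg hh] at h_orth
    refine ae_of_forall_ae_restrict_unitCube fun m => ?_
    refine (integrable_tsum_of_summable_integral_norm
      (fun i => integrableOn_conj_mul_comp_add_right _ _ (intVec k) _)
      (summable_setIntegral_norm_conj_mul hg hh _ _)).ae_eq_zero_of_forall_setIntegral_eq_zero
      fun s hs _ => ?_
    have h_inner := inner_mixedOp_modulates hg hh (hs.inter (measurableSet_unitCube (intVec m)))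
      Set.inter_subset_right (measurableSet_unitCube (intVec m + intVec k)) subset_rfl
    have h_sub : s ∩ unitCube (intVec m) ⊆ (· + intVec k) ⁻¹' unitCube (intVec m + intVec k) :=
      fun ξ hξ => add_mem_unitCube_add_iff.2 hξ.2
    rwa [h_orth, inner_zero_right, Set.inter_eq_left.2 h_sub, eq_comm,
      ← Measure.restrict_restrict hs] at h_inner
  · intro h_ae
    refine isOrthogonal_of_forall_inner_eq_zero hg hh
      (T := {f | ∃ (m : Fin d → ℤ) (E : Set (EuclideanSpace ℝ (Fin d))) (hE : MeasurableSet E)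
        (hEm : E ⊆ unitCube (intVec m)), cubeIndicator hE hEm = f})
      (fun w hw => eq_zero_of_forall_inner_cubeIndicator_eq_zero fun m E hE hEm =>
        hw _ ⟨m, E, hE, hEm, rfl⟩) ?_
    rintro _ ⟨m, E, hE, hEm, rfl⟩ _ ⟨m', F, hF, hFm, rfl⟩
    obtain ⟨k, rfl⟩ : ∃ k, m' = m + k := ⟨m' - m, (add_sub_cancel m m').symm⟩
    have hFk : F ⊆ unitCube (intVec m + intVec k) := by rwa [← intVec_add]
    refine (inner_mixedOp_modulates hg hh hE hEm hF hFk).trans ?_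
    rw [integral_congr_ae (ae_restrict_of_ae (h_ae k)), integral_zero]

end Modulates

section ShiftSystem

variable {ι : Type*}

/-- The translates of the family `g` along the lattice `X ℤ^d`. -/
def shiftSystem (X : GL (Fin d) ℝ) (g : ι → L2 d) : ι × (Fin d → ℤ) → L2 d := fun p =>
  translation (toEuclideanEquiv X (intVec p.2)) (g p.1)

/-- The unitary operator `f ↦ 𝓕 (D_X f)`, which turns translations along the lattice `X ℤ^d` into
multiplications by the characters of `ℤ^d`. -/
def fourierDilationEquiv (X : GL (Fin d) ℝ) : L2 d ≃ₗᵢ[ℂ] L2 d :=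
  (dilationEquiv X).trans (Lp.fourierTransformₗᵢ _ ℂ)

lemma fourierDilationEquiv_shiftSystem (X : GL (Fin d) ℝ) (g : ι → L2 d) :
    (fun p => fourierDilationEquiv X (shiftSystem X g p)) =
      modulates fun i => dilation (contragredient X) (𝓕 (g i) : L2 d) := by
  ext1 p
  change (𝓕 (dilation X (shiftSystem X g p)) : L2 d) = _
  rw [shiftSystem, ← translation_dilation, fourier_translation, fourier_dilation, modulates]

/-- The product `conj (f̂ (M ξ)) * ĝ (N (ξ + k))` of two Fourier transforms, in which the
orthogonality conditions are expressed. -/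
def fourierCorrelation (M N : Matrix (Fin d) (Fin d) ℝ) (f g : L2 d) (k : Fin d → ℤ)
    (ξ : EuclideanSpace ℝ (Fin d)) : ℂ :=
  conj ((𝓕 f : L2 d) (Matrix.toEuclideanLin M ξ)) *
    (𝓕 g : L2 d) (Matrix.toEuclideanLin N (ξ + intVec k))

lemma conj_dilation_mul_dilation_fourier (X Y : GL (Fin d) ℝ) (f g : L2 d) (k : Fin d → ℤ) :
    ∀ᵐ ξ, conj (dilation (contragredient X) (𝓕 f : L2 d) ξ) *
        dilation (contragredient Y) (𝓕 g : L2 d) (ξ + intVec k) =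
      (√|(contragredient X : Matrix (Fin d) (Fin d) ℝ).det| *
        √|(contragredient Y : Matrix (Fin d) (Fin d) ℝ).det| : ℂ) *
      fourierCorrelation (invTranspose X) (invTranspose Y) f g k ξ := by
  filter_upwards [coeFn_dilation (contragredient X) (𝓕 f : L2 d),
    ae_comp_add_right (intVec k) (coeFn_dilation (contragredient Y) (𝓕 g : L2 d))] with ξ hf hg
  rw [hf, hg, map_mul, Complex.conj_ofReal, mul_mul_mul_comm]
  rfl

variable {X Y : GL (Fin d) ℝ} {g h : ι → L2 d}

lemma IsBessel.modulates_fourier (hg : IsBessel (shiftSystem X g)) :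
    IsBessel (modulates fun i => dilation (contragredient X) (𝓕 (g i) : L2 d)) :=
  fourierDilationEquiv_shiftSystem X g ▸ hg.map (fourierDilationEquiv X)

variable [Countable ι]

lemma ae_summable_fourierCorrelation (hg : IsBessel (shiftSystem X g))
    (hh : IsBessel (shiftSystem Y h)) (k : Fin d → ℤ) :
    ∀ᵐ ξ, Summable fun i =>
      fourierCorrelation (invTranspose X) (invTranspose Y) (g i) (h i) k ξ := by
  filter_upwards [ae_summable_norm_conj_mul hg.modulates_fourier hh.modulates_fourier (intVec k),
    ae_all_iff.2 fun i => conj_dilation_mul_dilation_fourier X Y (g i) (h i) k] with ξ h_sum h_eq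
  simp only [h_eq] at h_sum
  exact (summable_mul_left_iff (mul_ne_zero (sqrt_abs_det_ne_zero _)
    (sqrt_abs_det_ne_zero _))).1 h_sum.of_norm

theorem isOrthogonal_shiftSystem_iff (hg : IsBessel (shiftSystem X g))
    (hh : IsBessel (shiftSystem Y h)) :
    IsOrthogonal (shiftSystem X g) (shiftSystem Y h) ↔ ∀ k : Fin d → ℤ, ∀ᵐ ξ,
      ∑' i, fourierCorrelation (invTranspose X) (invTranspose Y) (g i) (h i) k ξ = 0 := by
  rw [← isOrthogonal_map_iff (fourierDilationEquiv X) (fourierDilationEquiv Y),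
    fourierDilationEquiv_shiftSystem, fourierDilationEquiv_shiftSystem,
    isOrthogonal_modulates_iff hg.modulates_fourier hh.modulates_fourier]
  refine forall_congr' fun k => Filter.eventually_congr ?_
  filter_upwards [ae_all_iff.2 fun i => conj_dilation_mul_dilation_fourier X Y (g i) (h i) k]
    with ξ h_eq
  rw [tsum_congr h_eq, tsum_mul_left, mul_eq_zero_iff_left
    (mul_ne_zero (sqrt_abs_det_ne_zero _) (sqrt_abs_det_ne_zero _))]

end ShiftSystem

section Rigidity

/-- The map `S` intertwines the translations along the lattices `X ℤ^d` and `Y ℤ^d`: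
`S T_{Xz} = T_{Yz} S` for all `z ∈ ℤ^d`. -/
def IntertwinesShifts (X Y : GL (Fin d) ℝ) (S : L2 d → L2 d) : Prop :=
  ∀ (z : Fin d → ℤ) (v : L2 d), S (translation (toEuclideanEquiv X (intVec z)) v) =
    translation (toEuclideanEquiv Y (intVec z)) (S v)

variable {A B X Y : GL (Fin d) ℝ} {S T : L2 d → L2 d}

lemma IntertwinesShifts.neg (hS : IntertwinesShifts X Y S) :
    IntertwinesShifts X Y fun v => -S v := fun z v => by
  simp only [hS z]
  exact (map_neg (translationEquiv _) (S v)).symm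

lemma IntertwinesShifts.sub (hS : IntertwinesShifts X Y S) (hT : IntertwinesShifts X Y T) :
    IntertwinesShifts X Y fun v => S v - T v := fun z v => by
  simp only [hS z, hT z]
  exact (map_sub (translationEquiv _) (S v) (T v)).symm

lemma intertwinesShifts_mixedOp_shiftSystem {ι : Type*} (X Y : GL (Fin d) ℝ) (g h : ι → L2 d) :
    IntertwinesShifts X Y (mixedOp (shiftSystem X g) (shiftSystem Y h)) := fun z v => by
  have h_shift (Z : GL (Fin d) ℝ) (f : ι → L2 d) (p : ι × (Fin d → ℤ)) :
      translation (toEuclideanEquiv Z (intVec z)) (shiftSystem Z f p) =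
        shiftSystem Z f ((Equiv.refl ι).prodCongr (Equiv.addLeft z) p) := by
    simp [shiftSystem, translation_translation, intVec_add]
  have h_map := mixedOp_map (shiftSystem X g) (shiftSystem Y h)
    (translationEquiv (toEuclideanEquiv X (intVec z)))
    (translationEquiv (toEuclideanEquiv Y (intVec z))) v
  simp only [translationEquiv_apply, h_shift] at h_map
  rw [← h_map, mixedOp_comp_equiv]

lemma IsIntegerMatrix.exists_toEuclideanLin_intVec_eq {M : Matrix (Fin d) (Fin d) ℝ}
    (hM : IsIntegerMatrix M) (w : Fin d → ℤ) :
    ∃ u : Fin d → ℤ, Matrix.toEuclideanLin M (intVec w) = intVec u := by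
  choose m hm using hM
  refine ⟨Matrix.mulVec (.of m) w, ?_⟩
  ext i
  simp [intVec, Matrix.toLpLin_apply, Matrix.mulVec, dotProduct, hm]

lemma exists_toEuclideanLin_intVec_ne {M N : Matrix (Fin d) (Fin d) ℝ} (h : M ≠ N) :
    ∃ w : Fin d → ℤ, Matrix.toEuclideanLin M (intVec w) ≠ Matrix.toEuclideanLin N (intVec w) := by
  contrapose! h
  ext i j
  have h_col := congrArg (· i) (h (Pi.single j 1))
  have h_single : intVec (Pi.single j 1) = EuclideanSpace.single j 1 := by
    ext l
    simp [intVec, Pi.single_apply, apply_ite]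
  simpa [h_single, Matrix.toLpLin_apply] using h_col

theorem IntertwinesShifts.eq_zero_of_conj
    (hint : IsIntegerMatrix ((X⁻¹ * A * X : GL (Fin d) ℝ) : Matrix (Fin d) (Fin d) ℝ))
    (hne : X⁻¹ * A * X ≠ Y⁻¹ * B * Y) (hS : IntertwinesShifts X Y S)
    (hS_conj : IntertwinesShifts X Y fun v => dilation B (S ((dilation A).symm v)))
    (v : L2 d) : S v = 0 := by
  obtain ⟨w, hw⟩ := exists_toEuclideanLin_intVec_ne (Units.val_injective.ne hne)
  obtain ⟨u, hu⟩ := hint.exists_toEuclideanLin_intVec_eq w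
  have hA : toEuclideanEquiv A (toEuclideanEquiv X (intVec w)) =
      toEuclideanEquiv X (intVec u) := by
    rw [← hu, ← toEuclideanEquiv_apply, ← toEuclideanEquiv_mul_apply,
      ← toEuclideanEquiv_mul_apply, mul_assoc, mul_inv_cancel_left]
  have hB : toEuclideanEquiv Y (intVec u) ≠
      toEuclideanEquiv B (toEuclideanEquiv Y (intVec w)) := fun h => hw <| by
    rw [hu, ← toEuclideanEquiv_apply, mul_assoc, toEuclideanEquiv_mul_apply Y⁻¹,
      toEuclideanEquiv_mul_apply, ← h, ← toEuclideanEquiv_mul_apply, inv_mul_cancel, map_one]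
    rfl
  have h_conj := hS_conj w (dilation A v)
  simp only [translation_dilation, hA, LinearEquiv.symm_apply_apply, hS u] at h_conj
  exact eq_zero_of_translation_eq_translation hB ((dilation B).injective h_conj)

end Rigidity

section QuasiAffine

variable {r : ℕ}

/-- The functions `D̃_A^{-(n+1)} ψ_i`: their translates along `X ℤ^d` make up the part of the
quasi-affine system with negative dilation index. -/
def negativeGenerators (A : GL (Fin d) ℝ) (Ψ : Fin r → L2 d) : Fin r × ℕ → L2 d := fun q =>
  (renormDilation A ^ Int.negSucc q.2) (Ψ q.1)

lemma dilationEquiv_pow_apply (A : GL (Fin d) ℝ) (n : ℕ) (f : L2 d) :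
    (dilationEquiv A ^ n) f = (dilation A ^ n) f := by
  induction n generalizing f with
  | zero => rfl
  | succ _ ih => exact ih (dilation A f)

variable {J K : Type*}

/-- The position of the `n`-th dilate of a lattice translate in a quasi-affine system. -/
def nonnegativeIndex (p : ℕ × K × J) : ℤ × J × K := (p.1, p.2.2, p.2.1)

/-- The position of a lattice translate of a negative generator in a quasi-affine system. -/
def negativeIndex (p : (K × ℕ) × J) : ℤ × J × K := (Int.negSucc p.1.2, p.2, p.1.1)

lemma nonnegativeIndex_injective : Function.Injective (nonnegativeIndex : ℕ × K × J → _) := by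
  rintro ⟨n, i, z⟩ ⟨n', i', z'⟩ h
  simpa [nonnegativeIndex, and_comm] using h

lemma negativeIndex_injective : Function.Injective (negativeIndex : (K × ℕ) × J → _) := by
  rintro ⟨⟨i, n⟩, z⟩ ⟨⟨i', n'⟩, z'⟩ h
  simp only [negativeIndex, Prod.mk.injEq, Int.negSucc.injEq] at h
  simp [h]

lemma isCompl_range_nonnegativeIndex_negativeIndex :
    IsCompl (Set.range (nonnegativeIndex : ℕ × K × J → _)) (Set.range negativeIndex) := by
  refine isCompl_iff.2 ⟨Set.disjoint_range_iff.2 fun p q h => ?_, codisjoint_iff_le_sup.2 ?_⟩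
  · simp [nonnegativeIndex, negativeIndex] at h
  · rintro ⟨n | n, z, i⟩ -
    exacts [Or.inl ⟨(n, i, z), rfl⟩, Or.inr ⟨((i, n), z), rfl⟩]

lemma quasiAffine_nonnegativeIndex (A X : GL (Fin d) ℝ) (Ψ : Fin r → L2 d) :
    (fun p => quasiAffine A X Ψ (nonnegativeIndex p)) =
      orbit (dilationEquiv A) (shiftSystem X Ψ) := by
  ext1 p
  simp [quasiAffine, nonnegativeIndex, orbit, dilationEquiv_pow_apply, shiftSystem,
    toEuclideanEquiv_apply]

lemma quasiAffine_negativeIndex (A X : GL (Fin d) ℝ) (Ψ : Fin r → L2 d) :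
    (fun p => quasiAffine A X Ψ (negativeIndex p)) =
      shiftSystem X (negativeGenerators A Ψ) := by
  ext1 p
  simp [quasiAffine, negativeIndex, shiftSystem, negativeGenerators, toEuclideanEquiv_apply]

variable {A B X Y : GL (Fin d) ℝ} {Ψ Φ : Fin r → L2 d}

lemma IsBessel.orbit_shiftSystem (hΨ : IsBessel (quasiAffine A X Ψ)) :
    IsBessel (orbit (dilationEquiv A) (shiftSystem X Ψ)) :=
  quasiAffine_nonnegativeIndex A X Ψ ▸ hΨ.comp_injective nonnegativeIndex_injective

lemma IsBessel.shiftSystem_negativeGenerators (hΨ : IsBessel (quasiAffine A X Ψ)) :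
    IsBessel (shiftSystem X (negativeGenerators A Ψ)) :=
  quasiAffine_negativeIndex A X Ψ ▸ hΨ.comp_injective negativeIndex_injective

lemma mixedOp_quasiAffine (hΨ : IsBessel (quasiAffine A X Ψ)) (hΦ : IsBessel (quasiAffine B Y Φ))
    (v : L2 d) : mixedOp (quasiAffine A X Ψ) (quasiAffine B Y Φ) v =
      mixedOp (orbit (dilationEquiv A) (shiftSystem X Ψ))
        (orbit (dilationEquiv B) (shiftSystem Y Φ)) v +
      mixedOp (shiftSystem X (negativeGenerators A Ψ))
        (shiftSystem Y (negativeGenerators B Φ)) v := by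
  rw [mixedOp_eq_add hΨ hΦ nonnegativeIndex_injective negativeIndex_injective
    isCompl_range_nonnegativeIndex_negativeIndex v, quasiAffine_nonnegativeIndex,
    quasiAffine_nonnegativeIndex, quasiAffine_negativeIndex, quasiAffine_negativeIndex]

lemma isOrthogonal_orbit_of_isOrthogonal_quasiAffine
    (hint : IsIntegerMatrix ((X⁻¹ * A * X : GL (Fin d) ℝ) : Matrix (Fin d) (Fin d) ℝ))
    (hne : X⁻¹ * A * X ≠ Y⁻¹ * B * Y)
    (hΨ : IsBessel (quasiAffine A X Ψ)) (hΦ : IsBessel (quasiAffine B Y Φ))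
    (h : IsOrthogonal (quasiAffine A X Ψ) (quasiAffine B Y Φ)) :
    IsOrthogonal (orbit (dilationEquiv A) (shiftSystem X Ψ))
      (orbit (dilationEquiv B) (shiftSystem Y Φ)) := by
  rw [isOrthogonal_iff_mixedOp hΨ hΦ] at h
  rw [isOrthogonal_iff_mixedOp hΨ.orbit_shiftSystem hΦ.orbit_shiftSystem]
  set S := mixedOp (orbit (dilationEquiv A) (shiftSystem X Ψ))
    (orbit (dilationEquiv B) (shiftSystem Y Φ)) with hS
  have h_neg : S = fun v => -mixedOp (shiftSystem X (negativeGenerators A Ψ))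
      (shiftSystem Y (negativeGenerators B Φ)) v := by
    ext1 v
    rw [eq_neg_iff_add_eq_zero, hS, ← mixedOp_quasiAffine hΨ hΦ, h]
  have h_conj : (fun v => dilation B (S ((dilation A).symm v))) =
      fun v => S v - mixedOp (shiftSystem X Ψ) (shiftSystem Y Φ) v := by
    ext1 v
    exact eq_sub_of_add_eq' (mixedOp_orbit hΨ.orbit_shiftSystem hΦ.orbit_shiftSystem v).symm
  have hS_intertwines : IntertwinesShifts X Y S :=
    h_neg ▸ (intertwinesShifts_mixedOp_shiftSystem X Y _ _).neg
  exact hS_intertwines.eq_zero_of_conj hint hne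
    (h_conj ▸ hS_intertwines.sub (intertwinesShifts_mixedOp_shiftSystem X Y Ψ Φ))

theorem isOrthogonal_quasiAffine_iff
    (hint : IsIntegerMatrix ((X⁻¹ * A * X : GL (Fin d) ℝ) : Matrix (Fin d) (Fin d) ℝ))
    (hne : X⁻¹ * A * X ≠ Y⁻¹ * B * Y)
    (hΨ : IsBessel (quasiAffine A X Ψ)) (hΦ : IsBessel (quasiAffine B Y Φ)) :
    IsOrthogonal (quasiAffine A X Ψ) (quasiAffine B Y Φ) ↔
      IsOrthogonal (shiftSystem X Ψ) (shiftSystem Y Φ) ∧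
      IsOrthogonal (shiftSystem X (negativeGenerators A Ψ))
        (shiftSystem Y (negativeGenerators B Φ)) := by
  rw [← isOrthogonal_orbit_iff hΨ.orbit_shiftSystem hΦ.orbit_shiftSystem,
    isOrthogonal_iff_mixedOp hΨ.shiftSystem_negativeGenerators hΦ.shiftSystem_negativeGenerators]
  constructor
  · intro h
    have h_orbit := isOrthogonal_orbit_of_isOrthogonal_quasiAffine hint hne hΨ hΦ h
    refine ⟨h_orbit, fun v => ?_⟩
    rw [isOrthogonal_iff_mixedOp hΨ hΦ] at h
    rw [isOrthogonal_iff_mixedOp hΨ.orbit_shiftSystem hΦ.orbit_shiftSystem] at h_orbit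
    simpa [h, h_orbit] using (mixedOp_quasiAffine hΨ hΦ v).symm
  · rintro ⟨h_orbit, h_neg⟩
    rw [isOrthogonal_iff_mixedOp hΨ.orbit_shiftSystem hΦ.orbit_shiftSystem] at h_orbit
    refine (isOrthogonal_iff_mixedOp hΨ hΦ).2 fun v => ?_
    rw [mixedOp_quasiAffine hΨ hΦ, h_orbit, h_neg, add_zero]

lemma fourier_negativeGenerators (A X : GL (Fin d) ℝ) (Ψ : Fin r → L2 d) (q : Fin r × ℕ) :
    ∀ᵐ ξ, (𝓕 (negativeGenerators A Ψ q) : L2 d) (Matrix.toEuclideanLin (invTranspose X) ξ) =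
      (𝓕 (Ψ q.1) : L2 d) (Matrix.toEuclideanLin
        ((A : Matrix (Fin d) (Fin d) ℝ).transpose ^ (q.2 + 1) * invTranspose X) ξ) := by
  have h_coe : ((contragredient (A ^ Int.negSucc q.2) * contragredient X : GL (Fin d) ℝ) :
      Matrix (Fin d) (Fin d) ℝ) =
      (A : Matrix (Fin d) (Fin d) ℝ).transpose ^ (q.2 + 1) * invTranspose X := by
    rw [Units.val_mul, zpow_negSucc, coe_contragredient_inv, Units.val_pow_eq_pow_val,
      Matrix.transpose_pow, coe_contragredient]
  filter_upwards [ae_comp_toEuclideanEquiv (contragredient X)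
    (fourier_renormDilation_zpow A (Int.negSucc q.2) (Ψ q.1))] with ξ hξ
  rw [← h_coe, ← toEuclideanEquiv_apply, toEuclideanEquiv_mul_apply, ← hξ]
  rfl

lemma fourierCorrelation_negativeGenerators (A B X Y : GL (Fin d) ℝ) (Ψ Φ : Fin r → L2 d)
    (k : Fin d → ℤ) : ∀ᵐ ξ, ∀ q : Fin r × ℕ,
      fourierCorrelation (invTranspose X) (invTranspose Y) (negativeGenerators A Ψ q)
        (negativeGenerators B Φ q) k ξ =
      fourierCorrelation ((A : Matrix (Fin d) (Fin d) ℝ).transpose ^ (q.2 + 1) * invTranspose X)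
        ((B : Matrix (Fin d) (Fin d) ℝ).transpose ^ (q.2 + 1) * invTranspose Y)
        (Ψ q.1) (Φ q.1) k ξ := by
  refine ae_all_iff.2 fun q => ?_
  filter_upwards [fourier_negativeGenerators A X Ψ q,
    ae_comp_add_right (intVec k) (fourier_negativeGenerators B Y Φ q)] with ξ hA hB
  rw [fourierCorrelation, fourierCorrelation, hA, hB]

lemma ae_summable_fourierCorrelation_pow (hΨ : IsBessel (quasiAffine A X Ψ))
    (hΦ : IsBessel (quasiAffine B Y Φ)) (k : Fin d → ℤ) : ∀ᵐ ξ, Summable fun q : Fin r × ℕ =>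
      fourierCorrelation ((A : Matrix (Fin d) (Fin d) ℝ).transpose ^ (q.2 + 1) * invTranspose X)
        ((B : Matrix (Fin d) (Fin d) ℝ).transpose ^ (q.2 + 1) * invTranspose Y)
        (Ψ q.1) (Φ q.1) k ξ := by
  filter_upwards [ae_summable_fourierCorrelation hΨ.shiftSystem_negativeGenerators
    hΦ.shiftSystem_negativeGenerators k, fourierCorrelation_negativeGenerators A B X Y Ψ Φ k]
    with ξ h_sum h_eq
  exact h_sum.congr h_eq

lemma isOrthogonal_shiftSystem_negativeGenerators_iff (hΨ : IsBessel (quasiAffine A X Ψ))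
    (hΦ : IsBessel (quasiAffine B Y Φ)) :
    IsOrthogonal (shiftSystem X (negativeGenerators A Ψ))
        (shiftSystem Y (negativeGenerators B Φ)) ↔
      ∀ k : Fin d → ℤ, ∀ᵐ ξ, ∑ i : Fin r, ∑' j : ℕ, fourierCorrelation
        ((A : Matrix (Fin d) (Fin d) ℝ).transpose ^ (j + 1) * invTranspose X)
        ((B : Matrix (Fin d) (Fin d) ℝ).transpose ^ (j + 1) * invTranspose Y)
        (Ψ i) (Φ i) k ξ = 0 := by
  rw [isOrthogonal_shiftSystem_iff hΨ.shiftSystem_negativeGenerators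
    hΦ.shiftSystem_negativeGenerators]
  refine forall_congr' fun k => Filter.eventually_congr ?_
  filter_upwards [ae_summable_fourierCorrelation_pow hΨ hΦ k,
    fourierCorrelation_negativeGenerators A B X Y Ψ Φ k] with ξ h_sum h_eq
  rw [tsum_congr h_eq, h_sum.tsum_prod, tsum_fintype]

end QuasiAffine

end OrthogonalTranslates

end

theorem corollaryC_general {d r : ℕ} (A B X Y : GL (Fin d) ℝ)
    (hint : IsIntegerMatrix ((X⁻¹ * A * X : GL (Fin d) ℝ) : Matrix (Fin d) (Fin d) ℝ))
    (hne : X⁻¹ * A * X ≠ Y⁻¹ * B * Y)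
    (Ψ Φ : Fin r → L2 d)
    (hΨ : IsBessel (quasiAffine A X Ψ)) (hΦ : IsBessel (quasiAffine B Y Φ)) :
    (∀ k : Fin d → ℤ, ∀ᵐ ξ : EuclideanSpace ℝ (Fin d), ∀ i : Fin r,
      Summable fun j : ℕ =>
        conj ((𝓕 (Ψ i) : L2 d) (Matrix.toEuclideanLin
          ((A : Matrix (Fin d) (Fin d) ℝ).transpose ^ (j + 1) * invTranspose X) ξ)) *
        (𝓕 (Φ i) : L2 d) (Matrix.toEuclideanLin
          ((B : Matrix (Fin d) (Fin d) ℝ).transpose ^ (j + 1) * invTranspose Y)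
            (ξ + intVec k))) ∧
    (IsOrthogonal (quasiAffine A X Ψ) (quasiAffine B Y Φ) ↔
      (∀ k : Fin d → ℤ, ∀ᵐ ξ : EuclideanSpace ℝ (Fin d),
        ∑ i : Fin r,
          conj ((𝓕 (Ψ i) : L2 d) (Matrix.toEuclideanLin (invTranspose X) ξ)) *
          (𝓕 (Φ i) : L2 d) (Matrix.toEuclideanLin (invTranspose Y) (ξ + intVec k)) = 0) ∧
      (∀ k : Fin d → ℤ, ∀ᵐ ξ : EuclideanSpace ℝ (Fin d),
        ∑ i : Fin r, ∑' j : ℕ,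
          conj ((𝓕 (Ψ i) : L2 d) (Matrix.toEuclideanLin
            ((A : Matrix (Fin d) (Fin d) ℝ).transpose ^ (j + 1) * invTranspose X) ξ)) *
          (𝓕 (Φ i) : L2 d) (Matrix.toEuclideanLin
            ((B : Matrix (Fin d) (Fin d) ℝ).transpose ^ (j + 1) * invTranspose Y)
              (ξ + intVec k)) = 0)) := by
  refine ⟨fun k => ?_, ?_⟩
  · filter_upwards [ae_summable_fourierCorrelation_pow hΨ hΦ k] with ξ h_sum i
    exact h_sum.prod_factor i
  · rw [isOrthogonal_quasiAffine_iff hint hne hΨ hΦ,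
      isOrthogonal_shiftSystem_iff hΨ.orbit_shiftSystem.of_orbit hΦ.orbit_shiftSystem.of_orbit,
      isOrthogonal_shiftSystem_negativeGenerators_iff hΨ hΦ]
    simp only [tsum_fintype, fourierCorrelation]

theorem corollaryC {d r : ℕ} (A B X Y : GL (Fin d) ℝ)
    (hA : IsExpansive (A : Matrix (Fin d) (Fin d) ℝ))
    (hB : IsExpansive (B : Matrix (Fin d) (Fin d) ℝ))
    (hint : IsIntegerMatrix ((X⁻¹ * A * X : GL (Fin d) ℝ) : Matrix (Fin d) (Fin d) ℝ))
    (hne : X⁻¹ * A * X ≠ Y⁻¹ * B * Y)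
    (Ψ Φ : Fin r → L2 d)
    (hΨ : IsBessel (quasiAffine A X Ψ)) (hΦ : IsBessel (quasiAffine B Y Φ)) :
    (∀ k : Fin d → ℤ, ∀ᵐ ξ : EuclideanSpace ℝ (Fin d), ∀ i : Fin r,
      Summable fun j : ℕ =>
        conj ((𝓕 (Ψ i) : L2 d) (Matrix.toEuclideanLin
          ((A : Matrix (Fin d) (Fin d) ℝ).transpose ^ (j + 1) * invTranspose X) ξ)) *
        (𝓕 (Φ i) : L2 d) (Matrix.toEuclideanLin
          ((B : Matrix (Fin d) (Fin d) ℝ).transpose ^ (j + 1) * invTranspose Y)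
            (ξ + intVec k))) ∧
    (IsOrthogonal (quasiAffine A X Ψ) (quasiAffine B Y Φ) ↔
      (∀ k : Fin d → ℤ, ∀ᵐ ξ : EuclideanSpace ℝ (Fin d),
        ∑ i : Fin r,
          conj ((𝓕 (Ψ i) : L2 d) (Matrix.toEuclideanLin (invTranspose X) ξ)) *
          (𝓕 (Φ i) : L2 d) (Matrix.toEuclideanLin (invTranspose Y) (ξ + intVec k)) = 0) ∧
      (∀ k : Fin d → ℤ, ∀ᵐ ξ : EuclideanSpace ℝ (Fin d),
        ∑ i : Fin r, ∑' j : ℕ,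
          conj ((𝓕 (Ψ i) : L2 d) (Matrix.toEuclideanLin
            ((A : Matrix (Fin d) (Fin d) ℝ).transpose ^ (j + 1) * invTranspose X) ξ)) *
          (𝓕 (Φ i) : L2 d) (Matrix.toEuclideanLin
            ((B : Matrix (Fin d) (Fin d) ℝ).transpose ^ (j + 1) * invTranspose Y)
              (ξ + intVec k)) = 0)) :=
  corollaryC_general A B X Y hint hne Ψ Φ hΨ hΦ
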